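/- Let $\eta$ be an r.e. ("positive") equivalence relation on $\mathbb N$ with infinitely many equivalence classes. An $\eta$-family is a uniformly r.e. sequence $L_0,L_1,L_2,\ldots$ of pairwise distinct subsets of $\mathbb N$, each a union of $\eta$-equivalence classes. A text for $L\subseteq\mathbb N$ is a sequence $T:\mathbb N\to\mathbb N\cup\{\#\}$ whose set of values other than $\#$ is $L$; $T[n]$ denotes $T(0),\ldots,T(n-1)$. A learner is a recursive function $M:(\mathbb N\cup\{\#\})^*\to\mathbb N\cup\{?\}$. With respect to a hypothesis space $(H_e)_{e\in\mathbb N}$ and a class $\mathcal C$ of subsets of $\mathbb N$, the learner $M$ - explanatorily learns $\mathcal C$ if for every $L\in\mathcal C$ and every text $T$ for $L$ there is $n$ with $M(T[n])\in\mathbb N$, $H_{M(T[n])}=L$ and $M(T[j])=M(T[n])$ for all $j\ge n$; - finitely learns $\mathcal C$ if, in addition, $n$ can be chosen such that $M(T[m])=\,?$ for all $m<n$; - confidently learns $\mathcal C$ if it explanatorily learns $\mathcal C$ and for every text $T$ of every subset of $\mathbb N$ there is $n$ with $M(T[j])=M(T[n])$ for all $j\ge n$. An $\eta$-family $(L_i)_{i\in\mathbb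 N}$ is exactly learnable under a criterion if some learner learns $\{L_i:i\in\mathbb N\}$ under this criterion with respect to the hypothesis space $(L_i)_{i\in\mathbb N}$ itself. An $\eta$-family $(K_i)$ is a strong union of $\eta$-families $(L_i)$ and $(H_i)$ if $\{K_i\}=\{L_i\}\cup\{H_i\}$ and there are one-one recursive functions $f,g$ with $L_i=K_{f(i)}$ and $H_i=K_{g(i)}$ for all $i$. A criterion is strongly closed under union with respect to $\eta$ if every strong union of two $\eta$-families that are exactly learnable under it is again exactly learnable under it. Theorem. For every positive equivalence relation $\eta$ with infinitely many equivalence classes: 1. confident learning is strongly closed under union with respect to $\eta$; 2. explanatory learning is not strongly closed under union with respect to $\eta$; 3. if there is at least one $\eta$-family that is finitely learnable (with respect to the hypothesis space of the $\eta$-closures of $W_0,W_1,\ldots$, where $W_e$ is the domain of the $e$-th partial recursive function in an acceptable numbering), then finite learning is not strongly closed under union with respect to $\eta$. -/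

import Mathlib

namespace PosLearn

/-- A positive (recursively enumerable) equivalence relation on `ℕ`
with infinitely many equivalence classes. -/
structure IsPositive (η : Setoid ℕ) : Prop where
  re : REPred fun p : ℕ × ℕ => η p.1 p.2
  infinite : Infinite (Quotient η)

/-- A set is `η`-closed if it is a union of `η`-equivalence classes. -/
def EtaClosed (η : Setoid ℕ) (A : Set ℕ) : Prop :=
  ∀ x y, η x y → x ∈ A → y ∈ A

/-- The `η`-closure `[A]` of a set. -/
def etaClosure (η : Setoid ℕ) (A : Set ℕ) : Set ℕ := {x | ∃ y ∈ A, η y x}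

/-- `L 0, L 1, …` is (a one-one indexing of) an `η`-family: a uniformly r.e. sequence of
pairwise distinct `η`-closed sets. -/
structure IsFamily (η : Setoid ℕ) (L : ℕ → Set ℕ) : Prop where
  re : REPred fun p : ℕ × ℕ => p.2 ∈ L p.1
  injective : Function.Injective L
  closed : ∀ i, EtaClosed η (L i)

/-- A text: a sequence of numbers and pause symbols (`none` is the pause `#`). -/
abbrev Text := ℕ → Option ℕ

/-- The content of a text. -/
def Text.content (T : Text) : Set ℕ := {x | ∃ n, T n = some x}

/-- The initial segment `T(0), …, T(n-1)`. -/
def Text.initial (T : Text) (n : ℕ) : List (Option ℕ) := (List.range n).map T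

/-- The type of learners; `none` as an output is the symbol `?`.
Recursiveness is required separately, in `Learnable`. -/
abbrev Learner := List (Option ℕ) → Option ℕ

/-- A learning criterion relates a learner, a hypothesis space `W 0, W 1, …`,
and a class of languages. -/
abbrev Criterion := Learner → (ℕ → Set ℕ) → Set (Set ℕ) → Prop

/-- Explanatory learning: on every text for a language of the class the learner converges
to a single correct index. -/
def ExLearns : Criterion := fun M W C =>
  ∀ A ∈ C, ∀ T : Text, T.content = A →
    ∃ n e, M (T.initial n) = some e ∧ W e = A ∧
      ∀ j, n ≤ j → M (T.initial j) = M (T.initial n)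

/-- Confident learning: explanatory learning by a learner that converges on every text. -/
def ConfLearns : Criterion := fun M W C =>
  ExLearns M W C ∧
    ∀ T : Text, ∃ n, ∀ j, n ≤ j → M (T.initial j) = M (T.initial n)

/-- Finite (one-shot) learning: on every text for a language of the class the first
output other than `?` is a correct index and is kept forever. -/
def FinLearns : Criterion := fun M W C =>
  ∀ A ∈ C, ∀ T : Text, T.content = A →
    ∃ n e, M (T.initial n) = some e ∧ W e = A ∧
      (∀ m, m < n → M (T.initial m) = none) ∧
      ∀ j, n ≤ j → M (T.initial j) = M (T.initial n)

/-- The class `C` has a recursive `I`-learner with respect to the hypothesis space `W`. -/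
def Learnable (I : Criterion) (W : ℕ → Set ℕ) (C : Set (Set ℕ)) : Prop :=
  ∃ M : Learner, Computable M ∧ I M W C

/-- Exact learning: the family itself is the hypothesis space. -/
def ExactlyLearnable (I : Criterion) (L : ℕ → Set ℕ) : Prop :=
  Learnable I L (Set.range L)

/-- The default hypothesis space: the `η`-closures of the domains of the partial recursive
functions in an acceptable numbering. -/
def closedW (η : Setoid ℕ) (e : ℕ) : Set ℕ :=
  etaClosure η {x | ((Denumerable.ofNat Nat.Partrec.Code e).eval x).Dom}

/-- One-one reducibility between indexed families. -/
def OneOneReducible (L H : ℕ → Set ℕ) : Prop :=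
  ∃ f : ℕ → ℕ, Computable f ∧ Function.Injective f ∧ ∀ e, L e = H (f e)

/-- The `η`-family `K` is a strong union of `L` and `H`. -/
structure IsStrongUnion (η : Setoid ℕ) (L H K : ℕ → Set ℕ) : Prop where
  family : IsFamily η K
  union : Set.range K = Set.range L ∪ Set.range H
  left : OneOneReducible L K
  right : OneOneReducible H K

/-- `I` is strongly closed under union with respect to `η`: every strong union of two exactly
`I`-learnable `η`-families is exactly `I`-learnable. -/
def StronglyClosedUnderUnion (I : Criterion) (η : Setoid ℕ) : Prop :=
  ∀ L H K : ℕ → Set ℕ, IsFamily η L → IsFamily η H →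
    ExactlyLearnable I L → ExactlyLearnable I H →
    IsStrongUnion η L H K → ExactlyLearnable I K

end PosLearn

/-! Explanatory learning fails because of the chain attached to an enumeration `e` of a set meeting
infinitely many classes: its `k`-th member is the union of the first `k + 1` classes met by `e`. The
chain is learned by looking for the first element of the enumeration missing from the text, whereas
by Gold's argument (a learner has a stabilizing sequence for each set it learns, and that finite
sequence already lies in some member of the chain) no learner learns all members together with their
union. If the complement `U` of the class of `0` is r.e., adding `U` to the chain of a sequence
starting in `0` keeps that chain learnable, and the union with the chain of `U` is not. Otherwise no
learner learns `[0]` together with all pairs `[0] ∪ [y]`: given a stabilizing sequence for `[0]`,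
the numbers `y` such that some extension inside `[0] ∪ [y]` changes the learner's mind would
enumerate `U`. The pairs without `[0]` are learnable, and can be indexed one-one if members of the
chain are added.

Finite learners see a finite characteristic sample of each language and learn antichains only. The
closures of samples `G 0, G 2, G 4, …` and those of `G 0 ++ G 1` and of almost all of
`G 1, G 3, G 5, …` are two learnable antichains, but the closure of `G 0` is properly contained in
that of `G 0 ++ G 1`.

Confident learners for two families can be run in parallel: they converge on every text, to at most
two candidates, and the least number at which these differ decides between them in the limit. -/

namespace PosLearn

open Filter Encodable Set

section Computability

variable {α β : Type*} [Primcodable α] [Primcodable β]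

theorem computablePred_comp {p : β → Prop} {f : α → β} (hp : ComputablePred p)
    (hf : Computable f) : ComputablePred fun a => p (f a) := by
  classical
  exact (hp.decide.comp hf).computablePred

theorem computablePred_or {p q : α → Prop} (hp : ComputablePred p) (hq : ComputablePred q) :
    ComputablePred fun a => p a ∨ q a := by
  classical
  exact ((Primrec.or.to_comp.comp hp.decide hq.decide).of_eq fun a => by simp).computablePred

theorem computable_ite {p : α → Prop} [DecidablePred p] {f g : α → β} (hp : ComputablePred p)
    (hf : Computable f) (hg : Computable g) : Computable fun a => if p a then f a else g a :=
  (Computable.cond hp.decide hf hg).of_eq fun a => by by_cases h : p a <;> simp [h]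

theorem rePred_comp {p : β → Prop} {f : α → β} (hp : REPred p) (hf : Computable f) :
    REPred fun a => p (f a) :=
  Partrec.comp hp hf

theorem rePred_and {p q : α → Prop} (hp : REPred p) (hq : REPred q) :
    REPred fun a => p a ∧ q a :=
  (Partrec.bind hp (hq.comp Computable.fst).to₂).dom_re.of_eq fun a => by
    simp [Part.assert]

theorem rePred_or {p q : α → Prop} (hp : REPred p) (hq : REPred q) :
    REPred fun a => p a ∨ q a := by
  obtain ⟨k, hk, h⟩ := Partrec.merge' hp hq
  exact hk.dom_re.of_eq fun a => by simp [(h a).2, Part.assert]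

/-- `D s` is the `s`-th stage of a primitive recursive increasing approximation of the r.e.
predicate `p`. -/
structure IsStaged (p : α → Prop) (D : ℕ → α → Prop) : Prop where
  primrecPred : PrimrecPred fun q : ℕ × α => D q.1 q.2
  mono : ∀ {a s t}, s ≤ t → D s a → D t a
  iff : ∀ a, p a ↔ ∃ s, D s a

theorem IsStaged.sound {p : α → Prop} {D : ℕ → α → Prop} (h : IsStaged p D) {s : ℕ} {a : α}
    (ha : D s a) : p a :=
  (h.iff a).2 ⟨s, ha⟩

theorem IsStaged.eventually {p : α → Prop} {D : ℕ → α → Prop} (h : IsStaged p D) (a : α) :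
    ∀ᶠ s in atTop, (D s a ↔ p a) := by
  by_cases ha : p a
  · obtain ⟨s, hs⟩ := (h.iff a).1 ha
    filter_upwards [eventually_ge_atTop s] with t ht
    exact ⟨fun _ => ha, fun _ => h.mono ht hs⟩
  · exact Eventually.of_forall fun s => ⟨h.sound, fun h' => absurd h' ha⟩

theorem exists_isStaged {p : α → Prop} (hp : REPred p) : ∃ D, IsStaged p D := by
  obtain ⟨c, hc⟩ := Nat.Partrec.Code.exists_code.1 hp
  have eval_dom (a : α) : p a ↔ (c.eval (encode a)).Dom := by
    rw [hc]
    simp [Part.assert, Part.bind]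
  refine ⟨fun s a => (c.evaln s (encode a)).isSome = true, ?_, ?_, fun a => ?_⟩
  · exact Primrec.eq.comp (Primrec.option_isSome.comp (Nat.Partrec.Code.primrec_evaln.comp
      ((Primrec.fst.pair (Primrec.const c)).pair (Primrec.encode.comp Primrec.snd))))
      (Primrec.const true)
  · intro a s t hst h
    obtain ⟨x, hx⟩ := Option.isSome_iff_exists.1 h
    exact Option.isSome_iff_exists.2 ⟨x, Nat.Partrec.Code.evaln_mono hst hx⟩
  · simp only [eval_dom, Part.dom_iff_mem, Nat.Partrec.Code.evaln_complete,
      Option.isSome_iff_exists, Option.mem_def]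
    exact exists_comm

theorem rePred_exists_nat {R : α → ℕ → Prop} (h : REPred fun q : α × ℕ => R q.1 q.2) :
    REPred fun a => ∃ n, R a n := by
  classical
  obtain ⟨D, hD⟩ := exists_isStaged h
  have search : Partrec fun a =>
      Nat.rfind fun n => Part.some (decide (D n.unpair.2 (a, n.unpair.1))) := by
    refine Partrec.rfind (ComputablePred.decide
      (p := fun q : α × ℕ => D q.2.unpair.2 (q.1, q.2.unpair.1)) ?_).partrec
    have unpair := Computable.unpair.comp (Computable.snd (α := α) (β := ℕ))
    exact computablePred_comp hD.primrecPred.computablePred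
      ((Computable.snd.comp unpair).pair (Computable.fst.pair (Computable.fst.comp unpair)))
  refine search.dom_re.of_eq fun a => Nat.rfind_dom.trans ⟨?_, ?_⟩
  · rintro ⟨n, hn, -⟩
    exact ⟨_, hD.sound (by simpa using hn)⟩
  · rintro ⟨n, hn⟩
    obtain ⟨s, hs⟩ := (hD.iff (a, n)).1 hn
    exact ⟨Nat.pair n s, by simpa using hs, fun _ => trivial⟩

theorem rePred_exists {R : α → β → Prop} (h : REPred fun q : α × β => R q.1 q.2) :
    REPred fun a => ∃ b, R a b := by
  have decoded : REPred fun q : α × ℕ => ∃ b ∈ (decode q.2 : Option β), R q.1 b := by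
    refine ((Computable.decode.comp Computable.snd).ofOption.bind (Partrec.comp h
      ((Computable.fst.comp Computable.fst).pair Computable.snd)).to₂).dom_re.of_eq fun q => ?_
    simp [Part.dom_iff_mem]
  exact (rePred_exists_nat (R := fun a n => ∃ b ∈ (decode n : Option β), R a b)
    decoded).of_eq fun a =>
      ⟨fun ⟨_, b, _, hb⟩ => ⟨b, hb⟩, fun ⟨b, hb⟩ => ⟨encode b, b, by simp, hb⟩⟩

theorem rePred_forall_mem_list {R : α → β → Prop} (h : REPred fun q : α × β => R q.1 q.2) :
    REPred fun q : α × List β => ∀ b ∈ q.2, R q.1 b := by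
  obtain ⟨D, hD⟩ := exists_isStaged h
  have bounded : PrimrecRel fun (l : List β) (x : ℕ × α) => ∀ b ∈ l, D x.1 (x.2, b) := by
    refine PrimrecRel.forall_mem_list (R := fun (b : β) (x : ℕ × α) => D x.1 (x.2, b)) ?_
    exact hD.primrecPred.comp ((Primrec.fst.comp Primrec.snd).pair
      ((Primrec.snd.comp Primrec.snd).pair Primrec.fst))
  have uniform : REPred fun q : (α × List β) × ℕ => ∀ b ∈ q.1.2, D q.2 (q.1.1, b) :=
    (bounded.comp (Primrec.snd.comp Primrec.fst)
      (Primrec.snd.pair (Primrec.fst.comp Primrec.fst))).computablePred.to_re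
  refine (rePred_exists (R := fun (q : α × List β) s => ∀ b ∈ q.2, D s (q.1, b)) uniform).of_eq
    fun ⟨a, l⟩ =>
    ⟨fun ⟨s, hs⟩ b hb => hD.sound (hs b hb), fun hl => ?_⟩
  have : ∀ᶠ s in atTop, ∀ b ∈ l, D s (a, b) :=
    (List.finite_toSet l).eventually_all.2 fun b hb => (hD.eventually (a, b)).mono
      fun _ hs => hs.2 (hl b hb)
  exact this.exists

/-- The least `i < n` satisfying `P`, or `n` if there is none: the guess at stage `n` of a
search in the limit. -/
noncomputable def leastBelow (P : ℕ → Prop) (n : ℕ) : ℕ := sInf {i | n ≤ i ∨ P i}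

theorem isLeast_leastBelow (P : ℕ → Prop) (n : ℕ) :
    IsLeast {i | n ≤ i ∨ P i} (leastBelow P n) :=
  isLeast_csInf ⟨n, Or.inl le_rfl⟩

theorem computable_leastBelow {P : α → ℕ → Prop} {f : α → ℕ}
    (hP : ComputablePred fun q : α × ℕ => P q.1 q.2) (hf : Computable f) :
    Computable fun a => leastBelow (P a) (f a) := by
  classical
  have bounded : ComputablePred fun q : α × ℕ => f q.1 ≤ q.2 ∨ P q.1 q.2 :=
    computablePred_or (computablePred_comp Primrec.nat_le.computablePred
      ((hf.comp Computable.fst).pair Computable.snd)) hP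
  have exists_bounded (a : α) : ∃ i, f a ≤ i ∨ P a i := ⟨f a, Or.inl le_rfl⟩
  refine (Computable.find bounded exists_bounded).of_eq fun a => ?_
  have found : IsLeast {i | f a ≤ i ∨ P a i} (Nat.find (exists_bounded a)) :=
    ⟨Nat.find_spec (exists_bounded a), fun i hi => Nat.find_min' _ hi⟩
  exact found.unique (isLeast_leastBelow (P a) (f a))

theorem eventually_leastBelow {P : ℕ → ℕ → Prop} {Q : ℕ → Prop} {z : ℕ}
    (h : ∀ i, ∀ᶠ n in atTop, (P n i ↔ Q i)) (hz : IsLeast {i | Q i} z) :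
    ∀ᶠ n in atTop, leastBelow (P n) n = z := by
  filter_upwards [(finite_Iic z).eventually_all.2 fun i _ => h i, eventually_gt_atTop z]
    with n hn hzn
  refine (isLeast_leastBelow (P n) n).unique ⟨Or.inr ((hn z self_mem_Iic).2 hz.1), ?_⟩
  rintro i (hi | hi)
  · exact hzn.le.trans hi
  · by_contra! hiz
    exact hiz.not_ge (hz.2 ((hn i hiz.le).1 hi))

end Computability

section Texts

/-- The set of numbers occurring in a finite sequence, pauses being ignored. -/
def seqContent (σ : List (Option ℕ)) : Set ℕ := {x | some x ∈ σ}

theorem seqContent_append (σ τ : List (Option ℕ)) :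
    seqContent (σ ++ τ) = seqContent σ ∪ seqContent τ := by
  ext x
  simp [seqContent]

theorem finite_seqContent (σ : List (Option ℕ)) : (seqContent σ).Finite :=
  (List.finite_toSet σ).preimage (Option.some_injective ℕ).injOn

theorem Text.length_initial (T : Text) (n : ℕ) : (T.initial n).length = n := by
  simp [Text.initial]

theorem Text.mem_initial {T : Text} {n : ℕ} {o : Option ℕ} :
    o ∈ T.initial n ↔ ∃ i < n, T i = o := by
  simp [Text.initial]

theorem Text.seqContent_initial_subset (T : Text) (n : ℕ) :
    seqContent (T.initial n) ⊆ T.content :=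
  fun _ hx => (Text.mem_initial.1 hx).imp fun _ => And.right

theorem Text.eventually_mem (T : Text) (x : ℕ) :
    ∀ᶠ n in atTop, (some x ∈ T.initial n ↔ x ∈ T.content) := by
  by_cases hx : x ∈ T.content
  · obtain ⟨i, hi⟩ := hx
    filter_upwards [eventually_gt_atTop i] with n hn
    exact ⟨fun _ => ⟨i, hi⟩, fun _ => Text.mem_initial.2 ⟨i, hn, hi⟩⟩
  · exact Eventually.of_forall fun n =>
      ⟨fun h => T.seqContent_initial_subset n h, fun h => absurd h hx⟩

theorem Text.eventually_subset {T : Text} {A : Set ℕ} (hA : A.Finite) (h : A ⊆ T.content) :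
    ∀ᶠ n in atTop, A ⊆ seqContent (T.initial n) :=
  hA.eventually_all.2 fun x hx => (T.eventually_mem x).mono fun _ hn => hn.2 (h hx)

theorem Text.exists_initial_append (T : Text) {m n : ℕ} (h : m ≤ n) :
    ∃ τ, seqContent τ ⊆ T.content ∧ T.initial n = T.initial m ++ τ := by
  obtain ⟨k, rfl⟩ := Nat.exists_eq_add_of_le h
  refine ⟨(List.range k).map fun i => T (m + i), fun x hx => ?_, ?_⟩
  · obtain ⟨i, -, hi⟩ := List.mem_map.1 hx
    exact ⟨m + i, hi⟩
  · simp [Text.initial, List.range_add, Function.comp_def]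

theorem Text.initial_eq_of_prefix {T : Text} {n : ℕ} {σ : List (Option ℕ)}
    (h : σ <+: T.initial n) : T.initial σ.length = σ := by
  have hn : σ.length ≤ n := T.length_initial n ▸ h.length_le
  obtain ⟨τ, -, hτ⟩ := T.exists_initial_append hn
  have hpre : T.initial σ.length <+: T.initial n := hτ ▸ List.prefix_append _ _
  exact (List.prefix_of_prefix_length_le hpre h (T.length_initial _).le).eq_of_length
    (T.length_initial _)

theorem exists_text_content_eq (A : Set ℕ) : ∃ T : Text, T.content = A := by
  classical
  refine ⟨fun n => if n ∈ A then some n else none, ext fun x => ⟨?_, fun hx => ⟨x, if_pos hx⟩⟩⟩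
  rintro ⟨n, hn⟩
  obtain ⟨hA, rfl⟩ : n ∈ A ∧ n = x := by simpa using hn
  exact hA

theorem exists_limit_text {S : ℕ → List (Option ℕ)} (hS : ∀ n, S n <+: S (n + 1))
    (hlen : ∀ n, n ≤ (S n).length) :
    ∃ T : Text, (∀ n, T.initial (S n).length = S n) ∧ T.content = ⋃ n, seqContent (S n) := by
  have chain {m n : ℕ} (h : m ≤ n) : S m <+: S n := by
    induction n, h using Nat.le_induction with
    | base => exact List.prefix_rfl
    | succ k _ ih => exact ih.trans (hS k)
  obtain ⟨T, hT⟩ : ∃ T : Text, ∀ n, T.initial (S n).length = S n := by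
    refine ⟨fun i => (S (i + 1))[i]'(hlen (i + 1)), fun n =>
      List.ext_getElem (Text.length_initial _ _) fun i _ hi => ?_⟩
    simp only [Text.initial, List.getElem_map, List.getElem_range]
    rcases le_total (i + 1) n with h | h
    · exact (chain h).getElem _
    · exact ((chain h).getElem hi).symm
  refine ⟨T, hT, Subset.antisymm ?_ (iUnion_subset fun n => ?_)⟩
  · rintro x ⟨n, hn⟩
    refine mem_iUnion.2 ⟨n + 1, ?_⟩
    rw [← hT (n + 1)]
    exact Text.mem_initial.2 ⟨n, hlen (n + 1), hn⟩
  · rw [← hT n]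
    exact T.seqContent_initial_subset _

theorem exists_text_of_extension {A : Set ℕ} {σ : List (Option ℕ)} (hσ : seqContent σ ⊆ A)
    {ext : List (Option ℕ) → List (Option ℕ)} (hext : ∀ τ, seqContent (ext τ) ⊆ A) :
    ∃ T : Text, T.content = A ∧ T.initial σ.length = σ ∧
      ∃ᶠ n in atTop, ∃ m, T.initial m = T.initial n ++ ext (T.initial n) := by
  obtain ⟨c, rfl⟩ := exists_text_content_eq A
  let S : ℕ → List (Option ℕ) := fun n =>
    Nat.rec σ (fun n τ => (τ ++ [c n]) ++ ext (τ ++ [c n])) n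
  have succ (n : ℕ) : S (n + 1) = (S n ++ [c n]) ++ ext (S n ++ [c n]) := rfl
  have sub (n : ℕ) : seqContent (S n) ⊆ c.content := by
    induction n with
    | zero => exact hσ
    | succ k ih =>
      simp only [succ, seqContent_append, union_subset_iff]
      exact ⟨⟨ih, fun x hx => ⟨k, (List.mem_singleton.1 hx).symm⟩⟩, hext _⟩
  have le_length (n : ℕ) : n ≤ (S n).length := by
    induction n with
    | zero => omega
    | succ k ih => simp only [succ, List.length_append, List.length_singleton]; omega
  have pre (n : ℕ) : S n ++ [c n] <+: S (n + 1) := succ n ▸ List.prefix_append _ _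
  obtain ⟨T, hT, content⟩ := exists_limit_text
    (fun n => (List.prefix_append _ _).trans (pre n)) le_length
  refine ⟨T, ?_, hT 0, frequently_atTop.2 fun n =>
    ⟨(S n ++ [c n]).length, ?_, (S (n + 1)).length, ?_⟩⟩
  · refine content.trans (Subset.antisymm (iUnion_subset sub) fun x ⟨n, hn⟩ =>
      mem_iUnion.2 ⟨n + 1, ?_⟩)
    simp [seqContent, succ, hn]
  · exact (le_length n).trans (by simp)
  · rw [hT (n + 1), Text.initial_eq_of_prefix (hT (n + 1) ▸ pre n), succ]

theorem exists_text_extending {A : Set ℕ} {σ : List (Option ℕ)} (hσ : seqContent σ ⊆ A) :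
    ∃ T : Text, T.content = A ∧ T.initial σ.length = σ := by
  obtain ⟨T, hT, h, -⟩ := exists_text_of_extension (ext := fun _ => []) hσ
    fun _ _ hx => absurd hx List.not_mem_nil
  exact ⟨T, hT, h⟩

theorem primrecRel_some_mem : PrimrecRel fun (x : ℕ) (σ : List (Option ℕ)) => some x ∈ σ :=
  (PrimrecRel.exists_mem_list Primrec.eq).comp₂ Primrec₂.right
    (Primrec.option_some.comp Primrec.fst).to₂ |>.of_eq fun x σ => by simp

theorem primrec_reduceOption : Primrec (List.reduceOption : List (Option ℕ) → List ℕ) :=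
  Primrec.listFilterMap Primrec.id Primrec.snd.to₂

theorem rePred_seqContent_subset {α : Type*} [Primcodable α] {A : α → Set ℕ}
    (hA : REPred fun q : α × ℕ => q.2 ∈ A q.1) :
    REPred fun q : α × List (Option ℕ) => seqContent q.2 ⊆ A q.1 :=
  (rePred_comp (rePred_forall_mem_list (R := fun a x => x ∈ A a) hA) (Computable.fst.pair
    (primrec_reduceOption.to_comp.comp Computable.snd))).of_eq fun q => by
      simp [List.reduceOption_mem_iff, seqContent, subset_def]

theorem exists_primrec_text {α : Type*} [Primcodable α] {B : α → Set ℕ}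
    (hB : REPred fun q : α × ℕ => q.2 ∈ B q.1) :
    ∃ T : α → Text, Primrec₂ T ∧ ∀ a, (T a).content = B a := by
  classical
  obtain ⟨D, hD⟩ := exists_isStaged hB
  refine ⟨fun a n => if D n.unpair.1 (a, n.unpair.2) then some n.unpair.2 else none, ?_,
    fun a => ext fun x => ⟨?_, fun hx => ?_⟩⟩
  · have unpair := Primrec.unpair.comp (Primrec.snd (α := α) (β := ℕ))
    have stage : PrimrecPred fun q : α × ℕ => D q.2.unpair.1 (q.1, q.2.unpair.2) :=
      hD.primrecPred.comp ((Primrec.fst.comp unpair).pair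
        (Primrec.fst.pair (Primrec.snd.comp unpair)))
    exact Primrec.ite stage (Primrec.option_some.comp (Primrec.snd.comp unpair))
      (Primrec.const none)
  · rintro ⟨n, hn⟩
    obtain ⟨hs, rfl⟩ : D n.unpair.1 (a, n.unpair.2) ∧ n.unpair.2 = x := by simpa using hn
    exact hD.sound hs
  · obtain ⟨s, hs⟩ := (hD.iff (a, x)).1 hx
    exact ⟨Nat.pair s x, by simp [hs]⟩

theorem exists_primrec_enum {U : Set ℕ} (hU : REPred fun x => x ∈ U) (hne : U.Nonempty) :
    ∃ e : ℕ → ℕ, Primrec e ∧ range e = U := by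
  obtain ⟨x₀, hx₀⟩ := hne
  obtain ⟨T, hT, hcontent⟩ := exists_primrec_text (B := fun _ : Unit => U)
    (rePred_comp hU Computable.snd)
  refine ⟨fun n => (T () n).getD x₀, Primrec.option_getD.comp
    (hT.comp (Primrec.const ()) Primrec.id) (Primrec.const x₀), Subset.antisymm ?_ fun x hx => ?_⟩
  · rintro _ ⟨n, rfl⟩
    rcases h : T () n with _ | x
    · simpa [h] using hx₀
    · simpa [h] using hcontent () ▸ (⟨n, h⟩ : x ∈ (T ()).content)
  · obtain ⟨n, hn⟩ := (hcontent ()).symm ▸ hx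
    exact ⟨n, by simp [hn]⟩

end Texts

section Convergence

variable {M : Learner} {W : ℕ → Set ℕ} {C : Set (Set ℕ)}

theorem exLearns_iff : ExLearns M W C ↔ ∀ A ∈ C, ∀ T : Text, T.content = A →
    ∃ e, W e = A ∧ ∀ᶠ n in atTop, M (T.initial n) = some e := by
  simp only [ExLearns, eventually_atTop]
  refine forall₄_congr fun A _ T _ => ⟨?_, ?_⟩
  · rintro ⟨n, e, hn, he, hj⟩
    exact ⟨e, he, n, fun j h => (hj j h).trans hn⟩
  · rintro ⟨e, he, n, hn⟩
    exact ⟨n, e, hn n le_rfl, he, fun j hj => (hn j hj).trans (hn n le_rfl).symm⟩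

theorem exactlyLearnable_ex_of_eventually {L : ℕ → Set ℕ} {g : List (Option ℕ) → ℕ}
    (hg : Computable g)
    (h : ∀ i (T : Text), T.content = L i → ∀ᶠ n in atTop, g (T.initial n) = i) :
    ExactlyLearnable ExLearns L := by
  refine ⟨fun σ => some (g σ), Computable.option_some.comp hg, exLearns_iff.2 ?_⟩
  rintro _ ⟨i, rfl⟩ T hT
  exact ⟨i, rfl, (h i T hT).mono fun n hn => congrArg some hn⟩

theorem confLearns_of_eventually (h : ∀ T : Text, ∃ e,
    (∀ᶠ n in atTop, M (T.initial n) = some e) ∧ (T.content ∈ C → W e = T.content)) :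
    ConfLearns M W C := by
  refine ⟨exLearns_iff.2 fun A hA T hT => ?_, fun T => ?_⟩
  · obtain ⟨e, he, hW⟩ := h T
    exact ⟨e, (hW (hT ▸ hA)).trans hT, he⟩
  · obtain ⟨e, he, -⟩ := h T
    obtain ⟨n, hn⟩ := eventually_atTop.1 he
    exact ⟨n, fun j hj => (hn j hj).trans (hn n le_rfl).symm⟩

theorem ConfLearns.eventually_getD (h : ConfLearns M W C) (T : Text) :
    ∃ e, (∀ᶠ n in atTop, (M (T.initial n)).getD 0 = e) ∧ (T.content ∈ C → W e = T.content) := by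
  obtain ⟨n, hn⟩ := h.2 T
  have converges : ∀ᶠ j in atTop, M (T.initial j) = M (T.initial n) := eventually_atTop.2 ⟨n, hn⟩
  refine ⟨_, converges.mono fun j hj => congrArg (Option.getD · 0) hj, fun hC => ?_⟩
  obtain ⟨e, he, hev⟩ := exLearns_iff.1 h.1 _ hC T rfl
  obtain ⟨j, hj, hje⟩ := (converges.and hev).exists
  rw [← hj, hje, Option.getD_some, he]

end Convergence

section Stabilizing

variable {M : Learner} {W : ℕ → Set ℕ} {C : Set (Set ℕ)} {A B : Set ℕ} {σ : List (Option ℕ)}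

/-- `σ` is a stabilizing sequence for `M` on `A`: no extension of `σ` within `A` changes the
output of `M`. -/
structure IsStabilizing (M : Learner) (A : Set ℕ) (σ : List (Option ℕ)) : Prop where
  subset : seqContent σ ⊆ A
  eq : ∀ τ, seqContent τ ⊆ A → M (σ ++ τ) = M σ

theorem IsStabilizing.mono (h : IsStabilizing M A σ) (hB : seqContent σ ⊆ B) (hBA : B ⊆ A) :
    IsStabilizing M B σ :=
  ⟨hB, fun τ hτ => h.eq τ (hτ.trans hBA)⟩

theorem ExLearns.exists_isStabilizing (h : ExLearns M W C) (hA : A ∈ C) :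
    ∃ σ, IsStabilizing M A σ := by
  by_contra! hcon
  have extend (σ : List (Option ℕ)) :
      ∃ τ, seqContent τ ⊆ A ∧ (seqContent σ ⊆ A → M (σ ++ τ) ≠ M σ) := by
    by_contra! hσ
    have hsub : seqContent σ ⊆ A := (hσ [] fun _ hx => absurd hx List.not_mem_nil).1
    exact hcon σ ⟨hsub, fun τ hτ => (hσ τ hτ).2⟩
  choose ext ext_subset ext_ne using extend
  obtain ⟨T, hT, -, hfreq⟩ := exists_text_of_extension (A := A) (σ := [])
    (fun _ hx => absurd hx List.not_mem_nil) ext_subset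
  obtain ⟨e, -, hev⟩ := exLearns_iff.1 h A hA T hT
  obtain ⟨n, ⟨m, hm⟩, hn⟩ :=
    (hfreq.and_eventually (eventually_forall_ge_atTop.2 hev)).exists
  refine ext_ne _ (hT ▸ T.seqContent_initial_subset n) ?_
  have hle : n ≤ m := by
    have := congrArg List.length hm
    simp only [List.length_append, Text.length_initial] at this
    omega
  rw [← hm, hn m hle, hn n le_rfl]

theorem ExLearns.correct_of_isStabilizing (h : ExLearns M W C) (hA : A ∈ C)
    (hσ : IsStabilizing M A σ) : ∃ e, M σ = some e ∧ W e = A := by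
  obtain ⟨T, hT, hTσ⟩ := exists_text_extending hσ.subset
  obtain ⟨e, he, hev⟩ := exLearns_iff.1 h A hA T hT
  obtain ⟨n, hn, hle⟩ := (hev.and (eventually_ge_atTop σ.length)).exists
  obtain ⟨τ, hτ, happ⟩ := T.exists_initial_append hle
  rw [hTσ] at happ
  exact ⟨e, by rw [← hσ.eq τ (hT ▸ hτ), ← happ, hn], he⟩

theorem ExLearns.eq_of_isStabilizing (h : ExLearns M W C) (hA : A ∈ C) (hB : B ∈ C)
    (hσA : IsStabilizing M A σ) (hσB : IsStabilizing M B σ) : A = B := by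
  obtain ⟨a, ha, rfl⟩ := h.correct_of_isStabilizing hA hσA
  obtain ⟨b, hb, rfl⟩ := h.correct_of_isStabilizing hB hσB
  exact congrArg W (Option.some_injective _ (ha.symm.trans hb))

theorem not_exLearns_of_monotone {L : ℕ → Set ℕ} (hL : Monotone L) (hLC : ∀ k, L k ∈ C)
    (hC : ⋃ k, L k ∈ C) (hne : ∀ k, L k ≠ ⋃ k, L k) : ¬ ExLearns M W C := by
  intro h
  obtain ⟨σ, hσ⟩ := h.exists_isStabilizing hC
  have covered : ∀ᶠ k in atTop, seqContent σ ⊆ L k :=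
    (finite_seqContent σ).eventually_all.2 fun x hx => by
      obtain ⟨k, hk⟩ := mem_iUnion.1 (hσ.subset hx)
      exact (eventually_ge_atTop k).mono fun j hj => hL hj hk
  obtain ⟨k, hk⟩ := covered.exists
  exact hne k (h.eq_of_isStabilizing (hLC k) hC (hσ.mono hk (subset_iUnion L k)) hσ)

end Stabilizing

section Families

variable {η : Setoid ℕ}

/-- The sequence `b, f 0, f 1, …`. -/
def consSeq {β : Type*} (b : β) (f : ℕ → β) : ℕ → β
  | 0 => b
  | n + 1 => f n

theorem primrec_consSeq {β : Type*} [Primcodable β] (b : β) {f : ℕ → β} (hf : Primrec f) :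
    Primrec (consSeq b f) :=
  (Primrec.nat_casesOn₁ b hf).of_eq fun n => by cases n <;> rfl

theorem computable_consSeq {β : Type*} [Primcodable β] (b : β) {f : ℕ → β} (hf : Computable f) :
    Computable (consSeq b f) :=
  (Computable.nat_casesOn Computable.id (Computable.const b)
    (hf.comp Computable.snd).to₂).of_eq fun n => by cases n <;> rfl

theorem isFamily_consSeq {A : Set ℕ} {L : ℕ → Set ℕ} (hA : REPred fun x => x ∈ A)
    (hAc : EtaClosed η A) (hL : IsFamily η L) (hne : ∀ n, L n ≠ A) :
    IsFamily η (consSeq A L) where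
  re := by
    have cases : REPred fun p : ℕ × ℕ => p.1 = 0 ∧ p.2 ∈ A ∨ 0 < p.1 ∧ p.2 ∈ L (p.1 - 1) :=
      rePred_or
        (rePred_and (Primrec.eq.comp Primrec.fst (Primrec.const 0)).computablePred.to_re
          (rePred_comp hA Computable.snd))
        (rePred_and (Primrec.nat_lt.comp (Primrec.const 0) Primrec.fst).computablePred.to_re
          (rePred_comp hL.re ((Primrec.pred.comp Primrec.fst).pair Primrec.snd).to_comp))
    exact cases.of_eq fun ⟨n, x⟩ => by cases n <;> simp [consSeq]
  injective := by
    rintro (_ | n) (_ | m) h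
    · rfl
    · exact absurd h.symm (hne m)
    · exact absurd h (hne n)
    · exact congrArg _ (hL.injective h)
  closed := by
    rintro (_ | n)
    · exact hAc
    · exact hL.closed n

theorem exactlyLearnable_consSeq {A : Set ℕ} {L : ℕ → Set ℕ} {a : ℕ} (haA : a ∉ A)
    (haL : ∀ n, a ∈ L n) (h : ExactlyLearnable ExLearns L) :
    ExactlyLearnable ExLearns (consSeq A L) := by
  classical
  obtain ⟨M, hM, hL⟩ := h
  refine ⟨fun σ => if some a ∈ σ then (M σ).map Nat.succ else some 0,
    computable_ite (primrecRel_some_mem.comp (Primrec.const a) Primrec.id).computablePred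
      (Computable.option_map hM (Computable.succ.comp Computable.snd).to₂) (Computable.const _),
    exLearns_iff.2 ?_⟩
  rintro _ ⟨_ | n, rfl⟩ T hT
  · refine ⟨0, rfl, (T.eventually_mem a).mono fun n hn => if_neg (hn.not.2 ?_)⟩
    exact hT ▸ haA
  · obtain ⟨i, hi, hev⟩ := exLearns_iff.1 hL _ (mem_range_self n) T hT
    refine ⟨i + 1, hi, ?_⟩
    filter_upwards [T.eventually_mem a, hev] with n hn hMn
    rw [if_pos (hn.2 (hT ▸ haL _)), hMn, Option.map_some]

/-- The family listing alternately the members of `L` and those of `H`. -/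
def interleave (L H : ℕ → Set ℕ) : ℕ → Set ℕ :=
  Sum.elim L H ∘ Denumerable.ofNat (ℕ ⊕ ℕ)

theorem interleave_encode (L H : ℕ → Set ℕ) (i : ℕ ⊕ ℕ) :
    interleave L H (encode i) = Sum.elim L H i := by
  simp [interleave]

theorem isFamily_interleave {L H : ℕ → Set ℕ} (hL : IsFamily η L) (hH : IsFamily η H)
    (hne : ∀ i j, L i ≠ H j) : IsFamily η (interleave L H) where
  re := by
    have cases := (Partrec.sumCasesOn ((Computable.ofNat (ℕ ⊕ ℕ)).comp Computable.fst)
      (hL.re.comp (Computable.snd.pair (Computable.snd.comp Computable.fst))).to₂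
      (hH.re.comp (Computable.snd.pair (Computable.snd.comp Computable.fst))).to₂).dom_re
    refine cases.of_eq fun ⟨n, x⟩ => ?_
    rcases h : Denumerable.ofNat (ℕ ⊕ ℕ) n with i | i <;> simp [interleave, h, Part.assert]
  injective := (hL.injective.sumElim hH.injective hne).comp (Denumerable.eqv (ℕ ⊕ ℕ)).symm.injective
  closed n := by
    rw [interleave, Function.comp_apply]
    cases Denumerable.ofNat (ℕ ⊕ ℕ) n
    · exact hL.closed _
    · exact hH.closed _

theorem isStrongUnion_interleave {L H : ℕ → Set ℕ} (hL : IsFamily η L) (hH : IsFamily η H)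
    (hne : ∀ i j, L i ≠ H j) : IsStrongUnion η L H (interleave L H) where
  family := isFamily_interleave hL hH hne
  union := by
    rw [← Sum.elim_range]
    exact (Denumerable.eqv (ℕ ⊕ ℕ)).symm.surjective.range_comp _
  left := ⟨fun i => encode (Sum.inl i : ℕ ⊕ ℕ), Computable.encode.comp Primrec.sumInl.to_comp,
    encode_injective.comp Sum.inl_injective, fun i => (interleave_encode L H (Sum.inl i)).symm⟩
  right := ⟨fun i => encode (Sum.inr i : ℕ ⊕ ℕ), Computable.encode.comp Primrec.sumInr.to_comp,
    encode_injective.comp Sum.inr_injective, fun i => (interleave_encode L H (Sum.inr i)).symm⟩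

theorem not_stronglyClosed_of_disjoint {I : Criterion} {L H : ℕ → Set ℕ} (hL : IsFamily η L)
    (hH : IsFamily η H) (hne : ∀ i j, L i ≠ H j) (lL : ExactlyLearnable I L)
    (lH : ExactlyLearnable I H) (hI : ∀ W, ¬ Learnable I W (range L ∪ range H)) :
    ¬ StronglyClosedUnderUnion I η := by
  intro h
  have hU := isStrongUnion_interleave hL hH hne
  have learnable := h L H _ hL hH lL lH hU
  rw [ExactlyLearnable, hU.union] at learnable
  exact hI _ learnable

end Families

section Closure

variable {η : Setoid ℕ}

theorem subset_etaClosure (A : Set ℕ) : A ⊆ etaClosure η A :=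
  fun x hx => ⟨x, hx, η.refl x⟩

theorem etaClosed_etaClosure (A : Set ℕ) : EtaClosed η (etaClosure η A) :=
  fun _ _ hxy ⟨z, hz, hzx⟩ => ⟨z, hz, η.trans hzx hxy⟩

theorem etaClosure_subset_iff {A B : Set ℕ} (hB : EtaClosed η B) :
    etaClosure η A ⊆ B ↔ A ⊆ B :=
  ⟨(subset_etaClosure A).trans, fun h _ ⟨y, hy, hyx⟩ => hB y _ hyx (h hy)⟩

theorem image_mk_etaClosure (A : Set ℕ) :
    Quotient.mk η '' etaClosure η A = Quotient.mk η '' A := by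
  refine Subset.antisymm ?_ (image_mono (subset_etaClosure A))
  rintro _ ⟨x, ⟨y, hy, hyx⟩, rfl⟩
  exact ⟨y, hy, Quotient.sound hyx⟩

theorem rePred_etaClosure {α : Type*} [Primcodable α] (hη : REPred fun p : ℕ × ℕ => η p.1 p.2)
    {A : α → Set ℕ} (hA : REPred fun q : α × ℕ => q.2 ∈ A q.1) :
    REPred fun q : α × ℕ => q.2 ∈ etaClosure η (A q.1) :=
  rePred_exists (R := fun (q : α × ℕ) y => y ∈ A q.1 ∧ η y q.2) (rePred_and
    (rePred_comp hA ((Computable.fst.comp Computable.fst).pair Computable.snd))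
    (rePred_comp hη (Computable.snd.pair (Computable.snd.comp Computable.fst))))

end Closure

section ClassCount

variable {η : Setoid ℕ} {A B : Set ℕ}

/-- The number of equivalence classes that a set meets, `⊤` if there are infinitely many. -/
noncomputable def classCount (η : Setoid ℕ) (A : Set ℕ) : ℕ∞ := (Quotient.mk η '' A).encard

theorem classCount_mono (h : A ⊆ B) : classCount η A ≤ classCount η B :=
  encard_le_encard (image_mono h)

theorem classCount_etaClosure (A : Set ℕ) : classCount η (etaClosure η A) = classCount η A :=
  congrArg encard (image_mk_etaClosure A)

theorem classCount_univ (h : Infinite (Quotient η)) : classCount η univ = ⊤ := by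
  rw [classCount, image_univ_of_surjective Quotient.mk_surjective, encard_univ,
    ENat.card_eq_top_of_infinite]

end ClassCount

section Rank

variable {R S : ℕ → ℕ → Prop} {e : ℕ → ℕ}

/-- No earlier member of the enumeration `e` is related to `e j`. -/
def IsNew (R : ℕ → ℕ → Prop) (e : ℕ → ℕ) (j : ℕ) : Prop := ∀ i < j, ¬ R (e i) (e j)

open Classical in
/-- The number of `j < i` for which `e j` is new. If `R` is an equivalence relation, this is the
number of classes met by `e 0, …, e (i - 1)`; `R` can also be a finite stage of the enumeration of
such a relation, so that the rank is a limit of computable approximations. -/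
noncomputable def rank (R : ℕ → ℕ → Prop) (e : ℕ → ℕ) (i : ℕ) : ℕ := Nat.count (IsNew R e) i

theorem rank_mono : Monotone (rank R e) := by
  classical
  exact Nat.count_monotone _

theorem rank_succ_le (i : ℕ) : rank R e (i + 1) ≤ rank R e i + 1 := by
  classical
  rw [rank, Nat.count_succ]
  split_ifs <;> simp [rank]

theorem rank_one : rank R e 1 = 1 := by
  classical
  simp [rank, Nat.count_one, IsNew]

theorem rank_anti (h : ∀ x y, R x y → S x y) (i : ℕ) : rank S e i ≤ rank R e i := by
  classical
  exact Nat.count_mono_left fun _ _ hj k hk hR => hj k hk (h _ _ hR)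

theorem eventually_rank_eq {D : ℕ → ℕ × ℕ → Prop}
    (hD : IsStaged (fun p : ℕ × ℕ => R p.1 p.2) D) (i : ℕ) :
    ∀ᶠ s in atTop, rank (Function.curry (D s)) e i = rank R e i := by
  classical
  have agree : ∀ᶠ s in atTop, ∀ j ∈ Iio i, ∀ k ∈ Iio i,
      (D s (e k, e j) ↔ R (e k) (e j)) :=
    (finite_Iio i).eventually_all.2 fun j _ =>
      (finite_Iio i).eventually_all.2 fun k _ => hD.eventually (e k, e j)
  filter_upwards [agree] with s hs
  have isNew_iff (j : ℕ) (hj : j < i) : IsNew (Function.curry (D s)) e j ↔ IsNew R e j :=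
    forall₂_congr fun k hk => not_congr (hs j hj k (hk.trans hj))
  exact le_antisymm (Nat.count_mono_left fun j hj => (isNew_iff j hj).1)
    (Nat.count_mono_left fun j hj => (isNew_iff j hj).2)

theorem primrec_count {α : Type*} [Primcodable α] {P : ℕ → α → Prop} [∀ a, DecidablePred (P · a)]
    (hP : PrimrecRel P) : Primrec₂ fun (a : α) n => Nat.count (P · a) n := by
  classical
  exact (Primrec.list_length.comp (hP.listFilter.comp (Primrec.list_range.comp Primrec.snd)
    Primrec.fst)).of_eq fun q => by
      simp only [Nat.count, List.countP_eq_length_filter]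

theorem primrec_rank {D : ℕ → ℕ × ℕ → Prop} (hD : PrimrecPred fun q : ℕ × ℕ × ℕ => D q.1 q.2)
    (he : Primrec e) : Primrec₂ fun s i => rank (Function.curry (D s)) e i := by
  classical
  have related : PrimrecRel fun (k : ℕ) (q : ℕ × ℕ) => ¬ D q.2 (e k, e q.1) :=
    (hD.comp ((Primrec.snd.comp Primrec.snd).pair ((he.comp Primrec.fst).pair
      (he.comp (Primrec.fst.comp Primrec.snd))))).not
  have isNew : PrimrecRel fun j s => IsNew (Function.curry (D s)) e j :=
    (related.forall_mem_list.comp (Primrec.list_range.comp Primrec.fst) Primrec.id).of_eq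
      fun q => by simp [IsNew, Function.curry]
  exact primrec_count isNew

end Rank

section Chain

variable {η : Setoid ℕ} {e : ℕ → ℕ} {A : Set ℕ}

theorem exists_isNew (i : ℕ) : ∃ j, IsNew η e j ∧ η (e j) (e i) := by
  classical
  have related : ∃ j, η (e j) (e i) := ⟨i, η.refl _⟩
  exact ⟨Nat.find related, fun k hk hkj =>
    Nat.find_min related hk (η.trans hkj (Nat.find_spec related)), Nat.find_spec related⟩

theorem isNew_iff_mk_notMem {j : ℕ} :
    IsNew η e j ↔ Quotient.mk η (e j) ∉ Quotient.mk η '' (e '' Iio j) := by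
  simp [IsNew, Quotient.eq]

theorem rank_eq_classCount (i : ℕ) : (rank η e i : ℕ∞) = classCount η (e '' Iio i) := by
  classical
  induction i with
  | zero => simp [rank, classCount]
  | succ i ih =>
    rw [classCount, ← Order.succ_eq_add_one, Order.Iio_succ_eq_insert, image_insert_eq,
      image_insert_eq, Order.succ_eq_add_one]
    by_cases h : IsNew η e i
    · rw [encard_insert_of_notMem (isNew_iff_mk_notMem.1 h), ← classCount, ← ih]
      simp [rank, Nat.count_succ, h]
    · rw [insert_eq_of_mem (not_not.1 (isNew_iff_mk_notMem.not.1 h)), ← classCount, ← ih]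
      simp [rank, Nat.count_succ, h]

theorem exists_rank_eq (he : classCount η (range e) = ⊤) (k : ℕ) : ∃ i, rank η e i = k := by
  classical
  refine Nat.surjective_count_of_infinite_setOfPred (p := IsNew η e) (fun hfin => ?_) k
  refine encard_eq_top_iff.1 he ((hfin.image fun j => Quotient.mk η (e j)).subset ?_)
  rintro _ ⟨_, ⟨i, rfl⟩, rfl⟩
  obtain ⟨j, hj, hji⟩ := exists_isNew (η := η) (e := e) i
  exact ⟨j, hj, Quotient.sound hji⟩

/-- The union of the first `k + 1` classes in the order in which `e` meets them. -/
def chain (η : Setoid ℕ) (e : ℕ → ℕ) (k : ℕ) : Set ℕ := etaClosure η (e '' {i | rank η e i ≤ k})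

theorem chain_mono : Monotone (chain η e) :=
  fun _ _ hkl _ ⟨y, ⟨i, hi, hiy⟩, hyx⟩ => ⟨y, ⟨i, hi.trans hkl, hiy⟩, hyx⟩

theorem chain_subset (hA : EtaClosed η A) (he : range e ⊆ A) (k : ℕ) : chain η e k ⊆ A :=
  (etaClosure_subset_iff hA).2 ((image_subset_range _ _).trans he)

theorem mem_chain_rank (i : ℕ) : e i ∈ chain η e (rank η e i) :=
  subset_etaClosure _ (mem_image_of_mem e (le_refl (rank η e i)))

theorem iUnion_chain (he : EtaClosed η (range e)) : ⋃ k, chain η e k = range e := by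
  refine Subset.antisymm (iUnion_subset (chain_subset he Subset.rfl)) ?_
  rintro _ ⟨i, rfl⟩
  exact mem_iUnion.2 ⟨_, mem_chain_rank i⟩

theorem chain_zero : chain η e 0 = etaClosure η {e 0} := by
  have rank_pos (i : ℕ) (hi : 0 < i) : 0 < rank η e i := rank_one.symm.trans_le (rank_mono hi)
  have index_set : {i | rank η e i ≤ 0} = {0} := by
    ext i
    refine ⟨fun hi => ?_, ?_⟩
    · by_contra h
      exact (rank_pos i (Nat.pos_of_ne_zero h)).not_ge hi
    · rintro rfl
      simp [rank]
  rw [chain, index_set, image_singleton]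

theorem head_mem_chain (k : ℕ) : e 0 ∈ chain η e k :=
  chain_mono (Nat.zero_le k) (chain_zero ▸ subset_etaClosure {e 0} rfl)

theorem classCount_chain (he : classCount η (range e) = ⊤) (k : ℕ) :
    classCount η (chain η e k) = k + 1 := by
  classical
  have exceeds : ∃ i, k < rank η e i := (exists_rank_eq he (k + 1)).imp fun _ => by omega
  obtain ⟨z, hz, hmin⟩ : ∃ z, IsLeast {i | k < rank η e i} z :=
    ⟨Nat.find exceeds, Nat.find_spec exceeds, fun _ => Nat.find_min' exceeds⟩
  have index_set : {i | rank η e i ≤ k} = Iio z := by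
    ext i
    refine ⟨fun hi => ?_, fun hi => ?_⟩
    · by_contra h
      exact (hz.trans_le (rank_mono (not_lt.1 h))).not_ge hi
    · by_contra h
      exact (hmin (show k < rank η e i from not_le.1 h)).not_gt hi
  have rank_z : rank η e z = k + 1 := by
    obtain _ | y := z
    · exact absurd hz (by simp [rank])
    · have hy : y ∈ {i | rank η e i ≤ k} := index_set ▸ lt_add_one y
      exact ((rank_succ_le y).trans (Nat.succ_le_succ hy)).antisymm hz
  rw [chain, classCount_etaClosure, index_set, ← rank_eq_classCount, rank_z]
  simp

theorem chain_injective (he : classCount η (range e) = ⊤) : Function.Injective (chain η e) := by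
  intro k l hkl
  have := congrArg (classCount η) hkl
  rw [classCount_chain he, classCount_chain he] at this
  exact Nat.succ_injective (by exact_mod_cast this)

theorem exists_isLeast_missing (he : classCount η (range e) = ⊤) (hA : classCount η A ≠ ⊤) :
    ∃ z, IsLeast {i | e i ∉ A} z := by
  classical
  have missing : ∃ i, e i ∉ A := by
    by_contra! h
    exact hA (top_le_iff.1 (he ▸ classCount_mono (range_subset_iff.2 h)))
  exact ⟨Nat.find missing, Nat.find_spec missing, fun _ => Nat.find_min' missing⟩

theorem rank_le_classCount {z : ℕ} (hz : IsLeast {i | e i ∉ A} z) :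
    (rank η e z : ℕ∞) ≤ classCount η A := by
  rw [rank_eq_classCount]
  refine classCount_mono (image_subset_iff.2 fun i hi => ?_)
  by_contra h
  exact (hz.2 h).not_gt hi

theorem rank_of_isLeast_missing (he : classCount η (range e) = ⊤) {k z : ℕ}
    (hz : IsLeast {i | e i ∉ chain η e k} z) : rank η e z = k + 1 := by
  refine le_antisymm ?_ ?_
  · have := rank_le_classCount (η := η) hz
    rw [classCount_chain he] at this
    exact_mod_cast this
  · by_contra! h
    exact hz.1 (chain_mono (Nat.lt_succ_iff.1 h) (mem_chain_rank z))

theorem rePred_chain (hη : REPred fun p : ℕ × ℕ => η p.1 p.2) (he : Primrec e) :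
    REPred fun q : ℕ × ℕ => q.2 ∈ chain η e q.1 := by
  obtain ⟨D, hD⟩ := exists_isStaged hη
  refine rePred_etaClosure hη (A := fun k => e '' {i | rank η e i ≤ k}) ?_
  have stages : REPred fun p : (ℕ × ℕ) × ℕ × ℕ =>
      rank (Function.curry (D p.2.2)) e p.2.1 ≤ p.1.1 ∧ e p.2.1 = p.1.2 := by
    have index := Primrec.fst.comp (Primrec.snd (α := ℕ × ℕ) (β := ℕ × ℕ))
    refine (PrimrecPred.and (Primrec.nat_le.comp ?_ (Primrec.fst.comp Primrec.fst))
      (Primrec.eq.comp (he.comp index) (Primrec.snd.comp Primrec.fst))).computablePred.to_re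
    exact (primrec_rank hD.primrecPred he).comp (Primrec.snd.comp Primrec.snd) index
  refine (rePred_exists (R := fun (q p : ℕ × ℕ) =>
    rank (Function.curry (D p.2)) e p.1 ≤ q.1 ∧ e p.1 = q.2) stages).of_eq fun q => ⟨?_, ?_⟩
  · rintro ⟨p, hp, hpe⟩
    exact ⟨p.1, (rank_anti (fun _ _ => hD.sound) p.1).trans hp, hpe⟩
  · rintro ⟨i, hi, hie⟩
    obtain ⟨s, hs⟩ := (eventually_rank_eq (e := e) hD i).exists
    exact ⟨(i, s), hs.le.trans hi, hie⟩

theorem isFamily_chain (hη : REPred fun p : ℕ × ℕ => η p.1 p.2) (he : Primrec e)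
    (hinf : classCount η (range e) = ⊤) : IsFamily η (chain η e) :=
  ⟨rePred_chain hη he, chain_injective hinf, fun _ => etaClosed_etaClosure _⟩

/-- The learner for `chain η e`: one less than the approximate rank of the first element of `e`
missing from the input. -/
noncomputable def chainGuess (D : ℕ → ℕ × ℕ → Prop) (e : ℕ → ℕ) (σ : List (Option ℕ)) : ℕ :=
  rank (Function.curry (D σ.length)) e (leastBelow (fun i => some (e i) ∉ σ) σ.length) - 1

theorem computable_chainGuess {D : ℕ → ℕ × ℕ → Prop}
    (hD : PrimrecPred fun q : ℕ × ℕ × ℕ => D q.1 q.2) (he : Primrec e) :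
    Computable (chainGuess D e) := by
  have missing : ComputablePred fun q : List (Option ℕ) × ℕ => some (e q.2) ∉ q.1 :=
    (primrecRel_some_mem.comp (he.comp Primrec.snd) Primrec.fst).not.computablePred
  exact Primrec.pred.to_comp.comp ((primrec_rank hD he).to_comp.comp Computable.list_length
    (computable_leastBelow missing Computable.list_length))

theorem eventually_chainGuess {D : ℕ → ℕ × ℕ → Prop}
    (hD : IsStaged (fun p : ℕ × ℕ => η p.1 p.2) D) {T : Text} {z : ℕ}
    (hz : IsLeast {i | e i ∉ T.content} z) :
    ∀ᶠ n in atTop, chainGuess D e (T.initial n) = rank η e z - 1 := by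
  have missing (i : ℕ) : ∀ᶠ n in atTop, (some (e i) ∉ T.initial n ↔ e i ∉ T.content) :=
    (T.eventually_mem (e i)).mono fun _ => Iff.not
  filter_upwards [eventually_leastBelow missing hz, eventually_rank_eq hD z] with n hn hs
  rw [chainGuess, T.length_initial, hn, hs]

theorem eventually_chainGuess_of_eq_chain {D : ℕ → ℕ × ℕ → Prop}
    (hD : IsStaged (fun p : ℕ × ℕ => η p.1 p.2) D) (he : classCount η (range e) = ⊤) {T : Text}
    {k : ℕ} (hT : T.content = chain η e k) :
    ∀ᶠ n in atTop, chainGuess D e (T.initial n) = k := by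
  obtain ⟨z, hz⟩ := exists_isLeast_missing he (A := T.content)
    (by simp [hT, classCount_chain he])
  filter_upwards [eventually_chainGuess hD hz] with n hn
  rw [hn, rank_of_isLeast_missing he (hT ▸ hz), Nat.add_sub_cancel]

theorem exactlyLearnable_chain (hη : REPred fun p : ℕ × ℕ => η p.1 p.2) (he : Primrec e)
    (hinf : classCount η (range e) = ⊤) : ExactlyLearnable ExLearns (chain η e) := by
  obtain ⟨D, hD⟩ := exists_isStaged hη
  exact exactlyLearnable_ex_of_eventually (computable_chainGuess hD.primrecPred he)
    fun _ _ => eventually_chainGuess_of_eq_chain hD hinf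

end Chain

section ProperClosedSet

variable {η : Setoid ℕ}

theorem range_consSeq (a : ℕ) (e : ℕ → ℕ) : range (consSeq a e) = insert a (range e) :=
  (Nat.range_of_succ (consSeq a e)).symm

theorem not_stronglyClosed_ex_of_proper (hη : REPred fun p : ℕ × ℕ => η p.1 p.2) {U : Set ℕ}
    (hU : REPred fun x => x ∈ U) (hUc : EtaClosed η U) (hUinf : classCount η U = ⊤) {a : ℕ}
    (ha : a ∉ U) : ¬ StronglyClosedUnderUnion ExLearns η := by
  obtain ⟨e, he, rfl⟩ := exists_primrec_enum hU <| nonempty_iff_ne_empty.2 fun h => by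
    simp [h, classCount] at hUinf
  have cons_inf : classCount η (range (consSeq a e)) = ⊤ :=
    top_le_iff.1 (hUinf ▸ classCount_mono (range_consSeq a e ▸ subset_insert _ _))
  have a_mem (k : ℕ) : a ∈ chain η (consSeq a e) k := head_mem_chain (e := consSeq a e) k
  have a_notMem (k : ℕ) : a ∉ chain η e k := fun h => ha (chain_subset hUc Subset.rfl k h)
  have chain_ne (k : ℕ) : chain η e k ≠ range e := fun h => by
    have := classCount_chain hUinf k
    rw [h, hUinf] at this
    exact ENat.natCast_ne_top (k + 1) (by exact_mod_cast this.symm)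
  have cons_ne (k : ℕ) : chain η (consSeq a e) k ≠ range e := fun h => ha (h ▸ a_mem k)
  refine not_stronglyClosed_of_disjoint (isFamily_chain hη he hUinf)
    (isFamily_consSeq hU hUc (isFamily_chain hη (primrec_consSeq a he) cons_inf) cons_ne) ?_
    (exactlyLearnable_chain hη he hUinf)
    (exactlyLearnable_consSeq ha a_mem
      (exactlyLearnable_chain hη (primrec_consSeq a he) cons_inf)) fun W ⟨M, _, hM⟩ => ?_
  · rintro i (_ | j)
    · exact chain_ne i
    · exact fun h => a_notMem i (h ▸ a_mem j)
  · refine not_exLearns_of_monotone chain_mono (fun k => Or.inl ⟨k, rfl⟩) ?_ ?_ hM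
    · exact Or.inr ⟨0, (iUnion_chain hUc).symm⟩
    · exact fun k => (iUnion_chain hUc).symm ▸ chain_ne k

end ProperClosedSet

section Pairs

variable {η : Setoid ℕ}

theorem isFamily_comp {L : ℕ → Set ℕ} (hL : IsFamily η L) {f : ℕ → ℕ} (hf : Computable f)
    (hinj : Function.Injective f) : IsFamily η (L ∘ f) where
  re := rePred_comp hL.re ((hf.comp Computable.fst).pair Computable.snd)
  injective := hL.injective.comp hinj
  closed i := hL.closed (f i)

/-- The union of the classes of `0` and `y`. -/
def pairSet (η : Setoid ℕ) (y : ℕ) : Set ℕ := etaClosure η {0, y}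

theorem mem_pairSet {x y : ℕ} : x ∈ pairSet η y ↔ η 0 x ∨ η y x := by
  simp [pairSet, etaClosure]

theorem pairSet_congr {x y : ℕ} (h : η x y) : pairSet η x = pairSet η y := by
  ext z
  simp only [mem_pairSet]
  exact or_congr_right ⟨η.trans (η.symm h), η.trans h⟩

theorem classCount_pairSet {y : ℕ} (hy : ¬ η 0 y) : classCount η (pairSet η y) = 2 := by
  rw [pairSet, classCount_etaClosure, classCount, image_pair, encard_pair]
  exact fun h => hy (Quotient.exact h)

theorem rePred_pairSet (hη : REPred fun p : ℕ × ℕ => η p.1 p.2) :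
    REPred fun q : ℕ × ℕ => q.2 ∈ pairSet η q.1 :=
  (rePred_or (rePred_comp hη ((Computable.const 0).pair Computable.snd)) hη).of_eq fun _ =>
    mem_pairSet.symm

theorem rePred_of_exLearns_pairSet (hη : REPred fun p : ℕ × ℕ => η p.1 p.2) {M : Learner}
    {W : ℕ → Set ℕ} {C : Set (Set ℕ)} (hM : Computable M) (h : ExLearns M W C)
    (hzero : etaClosure η {0} ∈ C) (hpair : ∀ y, ¬ η 0 y → pairSet η y ∈ C) :
    REPred fun y => ¬ η 0 y := by
  classical
  obtain ⟨σ, hσ⟩ := h.exists_isStabilizing hzero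
  have mind_change : REPred fun y =>
      ∃ τ, seqContent τ ⊆ pairSet η y ∧ M (σ ++ τ) ≠ M σ := by
    refine rePred_exists (R := fun y τ => seqContent τ ⊆ pairSet η y ∧ M (σ ++ τ) ≠ M σ)
      (rePred_and (rePred_seqContent_subset (rePred_pairSet hη)) (ComputablePred.to_re ?_))
    exact (computablePred_comp (Primrec.eq.comp Primrec.id (Primrec.const (M σ))).computablePred
      (hM.comp (Computable.list_append.comp (Computable.const σ) Computable.snd))).not
  refine mind_change.of_eq fun y => ⟨?_, fun hy => ?_⟩
  · rintro ⟨τ, hτ, hne⟩ hy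
    refine hne (hσ.eq τ (hτ.trans fun x hx => ?_))
    rw [← pairSet_congr hy] at hx
    simpa [etaClosure, mem_pairSet] using hx
  · by_contra! hstable
    have hsub : etaClosure η {0} ⊆ pairSet η y := fun x hx =>
      mem_pairSet.2 (Or.inl (by simpa [etaClosure] using hx))
    have heq := h.eq_of_isStabilizing hzero (hpair y hy) hσ ⟨hσ.subset.trans hsub, hstable⟩
    have hmem : y ∈ etaClosure η {0} := heq ▸ mem_pairSet.2 (Or.inr (η.refl y))
    exact hy (by simpa [etaClosure] using hmem)

/-- A one-one indexing of the sets `pairSet η y`, for `y` not in the class of `0`, together with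
some members of the chain. Only the least `y + 1` in its class yields a pair, and the index of any
other one is diverted: as "not least" is r.e., the pair can grow into a member of the chain. -/
def pairFamily (η : Setoid ℕ) (y : ℕ) : Set ℕ :=
  pairSet η (y + 1) ∪ {x | ¬ IsNew η id (y + 1) ∧ x ∈ chain η id (2 * y + 3)}

theorem not_related_zero_of_isNew {y : ℕ} (h : IsNew η id (y + 1)) : ¬ η 0 (y + 1) :=
  h 0 y.succ_pos

theorem pairFamily_of_isNew {y : ℕ} (h : IsNew η id (y + 1)) :
    pairFamily η y = pairSet η (y + 1) := by
  simp [pairFamily, h]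

theorem pairFamily_of_not_isNew {y : ℕ} (h : ¬ IsNew η id (y + 1)) :
    pairFamily η y = chain η id (2 * y + 3) := by
  have le_mem (i : ℕ) (hi : i ≤ 2 * y + 3) : i ∈ chain η id (2 * y + 3) := by
    classical
    exact chain_mono ((Nat.count_le (p := IsNew η id)).trans hi) (mem_chain_rank (e := id) i)
  have subset : pairSet η (y + 1) ⊆ chain η id (2 * y + 3) := by
    refine (etaClosure_subset_iff (etaClosed_etaClosure _)).2 (pair_subset_iff.2 ?_)
    exact ⟨le_mem 0 (by omega), le_mem (y + 1) (by omega)⟩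
  simp [pairFamily, h, subset]

theorem pairFamily_spec (hinf : Infinite (Quotient η)) (y : ℕ) :
    IsNew η id (y + 1) ∧ pairFamily η y = pairSet η (y + 1) ∧ classCount η (pairFamily η y) = 2 ∨
      pairFamily η y = chain η id (2 * y + 3) ∧
        classCount η (pairFamily η y) = (2 * y + 4 : ℕ) := by
  by_cases h : IsNew η id (y + 1)
  · rw [pairFamily_of_isNew h]
    exact Or.inl ⟨h, rfl, classCount_pairSet (not_related_zero_of_isNew h)⟩
  · rw [pairFamily_of_not_isNew h, classCount_chain (by simpa using classCount_univ hinf)]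
    exact Or.inr ⟨rfl, by push_cast; ring⟩

theorem exists_pairFamily_eq {y : ℕ} (hy : ¬ η 0 y) : ∃ i, pairFamily η i = pairSet η y := by
  obtain ⟨_ | j, hj, hjy⟩ := exists_isNew (η := η) (e := id) y
  · exact absurd hjy hy
  · exact ⟨j, (pairFamily_of_isNew hj).trans (pairSet_congr hjy)⟩

theorem rePred_not_isNew (hη : REPred fun p : ℕ × ℕ => η p.1 p.2) :
    REPred fun j => ¬ IsNew η id j := by
  have related : REPred fun p : ℕ × ℕ => p.2 < p.1 ∧ η p.2 p.1 :=
    rePred_and (Primrec.nat_lt.comp Primrec.snd Primrec.fst).computablePred.to_re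
      (rePred_comp hη (Computable.snd.pair Computable.fst))
  exact (rePred_exists (R := fun j i => i < j ∧ η i j) related).of_eq fun j => by simp [IsNew]

theorem IsNew.le {x y : ℕ} (h : IsNew η id x) (hxy : η x y) : x ≤ y := by
  by_contra! hlt
  exact h y hlt (η.symm hxy)

theorem related_of_mem_pairSet {x y : ℕ} (h0 : ¬ η 0 x) (h : x ∈ pairSet η y) : η y x :=
  (mem_pairSet.1 h).resolve_left h0

theorem isFamily_pairFamily (hη : IsPositive η) : IsFamily η (pairFamily η) where
  re := by
    have pair : REPred fun q : ℕ × ℕ => q.2 ∈ pairSet η (q.1 + 1) :=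
      rePred_comp (p := fun q : ℕ × ℕ => q.2 ∈ pairSet η q.1) (rePred_pairSet hη.re)
        ((Computable.succ.comp Computable.fst).pair Computable.snd)
    have not_new : REPred fun q : ℕ × ℕ => ¬ IsNew η id (q.1 + 1) :=
      rePred_comp (p := fun j => ¬ IsNew η id j) (rePred_not_isNew hη.re)
        (Computable.succ.comp Computable.fst)
    have mem_chain : REPred fun q : ℕ × ℕ => q.2 ∈ chain η id (2 * q.1 + 3) :=
      rePred_comp (p := fun q : ℕ × ℕ => q.2 ∈ chain η id q.1) (rePred_chain hη.re Primrec.id)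
        ((Primrec.nat_add.comp (Primrec.nat_double.comp Primrec.fst) (Primrec.const 3)).pair
          Primrec.snd).to_comp
    exact rePred_or pair (rePred_and not_new mem_chain)
  injective x y h := by
    have hcount := congrArg (classCount η) h
    rcases pairFamily_spec hη.infinite x with ⟨hx, hxp, hxc⟩ | ⟨-, hxc⟩ <;>
      rcases pairFamily_spec hη.infinite y with ⟨hy, hyp, hyc⟩ | ⟨-, hyc⟩
    · have hyx : y + 1 ∈ pairSet η (x + 1) := by
        rw [← hxp, h, hyp]
        exact mem_pairSet.2 (Or.inr (η.refl _))
      have related := related_of_mem_pairSet (not_related_zero_of_isNew hy) hyx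
      exact Nat.succ_injective ((hx.le related).antisymm (hy.le (η.symm related)))
    all_goals
      rw [hxc, hyc] at hcount
      norm_cast at hcount
      omega
  closed y := by
    rcases pairFamily_spec hη.infinite y with ⟨-, h, -⟩ | ⟨h, -⟩ <;>
      exact h ▸ etaClosed_etaClosure _

theorem pairFamily_ne_chain (hinf : Infinite (Quotient η)) (y k : ℕ) :
    pairFamily η y ≠ chain η id (2 * k) := by
  intro h
  have hcount := congrArg (classCount η) h
  rw [classCount_chain (by simpa using classCount_univ hinf)] at hcount
  rcases pairFamily_spec hinf y with ⟨-, -, hc⟩ | ⟨-, hc⟩ <;>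
  · rw [hc] at hcount
    norm_cast at hcount
    omega

/-- The learner for `pairFamily η`. -/
noncomputable def pairFamilyGuess (D : ℕ → ℕ × ℕ → Prop) (σ : List (Option ℕ)) : ℕ :=
  open Classical in
  if chainGuess D id σ ≤ 1 then
    leastBelow (fun w => some (w + 1) ∈ σ ∧ ¬ D σ.length (0, w + 1)) σ.length
  else (chainGuess D id σ - 3) / 2

theorem computable_pairFamilyGuess {D : ℕ → ℕ × ℕ → Prop}
    (hD : PrimrecPred fun q : ℕ × ℕ × ℕ => D q.1 q.2) : Computable (pairFamilyGuess D) := by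
  have hchain := computable_chainGuess hD Primrec.id
  have pair_test : ComputablePred fun q : List (Option ℕ) × ℕ =>
      some (q.2 + 1) ∈ q.1 ∧ ¬ D q.1.length (0, q.2 + 1) :=
    ((primrecRel_some_mem.comp (Primrec.succ.comp Primrec.snd) Primrec.fst).and
      (hD.comp ((Primrec.list_length.comp Primrec.fst).pair
        ((Primrec.const 0).pair (Primrec.succ.comp Primrec.snd)))).not).computablePred
  exact computable_ite
    (computablePred_comp (Primrec.nat_le.comp Primrec.id (Primrec.const 1)).computablePred hchain)
    (computable_leastBelow pair_test Computable.list_length)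
    ((Primrec.nat_div.comp (Primrec.nat_sub.comp Primrec.id (Primrec.const 3))
      (Primrec.const 2)).to_comp.comp hchain)

theorem eventually_pairFamilyGuess (hinf : Infinite (Quotient η)) {D : ℕ → ℕ × ℕ → Prop}
    (hD : IsStaged (fun p : ℕ × ℕ => η p.1 p.2) D) {T : Text} {y : ℕ}
    (hT : T.content = pairFamily η y) :
    ∀ᶠ n in atTop, pairFamilyGuess D (T.initial n) = y := by
  have univ_inf : classCount η (range id) = ⊤ := by simpa using classCount_univ hinf
  rcases pairFamily_spec hinf y with ⟨hy, hpair, hcount⟩ | ⟨hchain, -⟩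
  · obtain ⟨z, hz⟩ := exists_isLeast_missing univ_inf (A := T.content) (by simp [hT, hcount])
    have rank_le : rank η id z ≤ 2 := by
      have := rank_le_classCount (η := η) hz
      rw [hT, hcount] at this
      exact_mod_cast this
    have test_iff (w : ℕ) : ∀ᶠ n in atTop, (some (w + 1) ∈ T.initial n ∧ ¬ D n (0, w + 1) ↔
        w + 1 ∈ pairSet η (y + 1) ∧ ¬ η 0 (w + 1)) := by
      filter_upwards [T.eventually_mem (w + 1), hD.eventually (0, w + 1)] with n hmem hrel
      rw [hmem, hrel, hT, hpair]
    have least : IsLeast {w | w + 1 ∈ pairSet η (y + 1) ∧ ¬ η 0 (w + 1)} y :=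
      ⟨⟨mem_pairSet.2 (Or.inr (η.refl _)), not_related_zero_of_isNew hy⟩, fun w hw =>
        Nat.succ_le_succ_iff.1 (hy.le (related_of_mem_pairSet hw.2 hw.1))⟩
    filter_upwards [eventually_chainGuess hD hz, eventually_leastBelow test_iff least]
      with n hguess hleast
    rw [pairFamilyGuess, if_pos (by omega), T.length_initial, hleast]
  · filter_upwards [eventually_chainGuess_of_eq_chain hD univ_inf (hT.trans hchain)] with n hguess
    rw [pairFamilyGuess, if_neg (by omega), hguess]
    omega

theorem exactlyLearnable_pairFamily (hη : IsPositive η) :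
    ExactlyLearnable ExLearns (pairFamily η) := by
  obtain ⟨D, hD⟩ := exists_isStaged hη.re
  exact exactlyLearnable_ex_of_eventually (computable_pairFamilyGuess hD.primrecPred)
    fun _ _ => eventually_pairFamilyGuess hη.infinite hD

theorem exactlyLearnable_ex_comp {L : ℕ → Set ℕ} (hL : Function.Injective L)
    (h : ExactlyLearnable ExLearns L) {f g : ℕ → ℕ} (hg : Computable g)
    (hgf : Function.LeftInverse g f) : ExactlyLearnable ExLearns (L ∘ f) := by
  obtain ⟨M, hM, hML⟩ := h
  refine ⟨fun σ => (M σ).map g, Computable.option_map hM (hg.comp Computable.snd).to₂,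
    exLearns_iff.2 ?_⟩
  rintro _ ⟨i, rfl⟩ T hT
  obtain ⟨e, he, hev⟩ := exLearns_iff.1 hML _ (mem_range_self (f i)) T hT
  refine ⟨i, rfl, hev.mono fun n hn => ?_⟩
  rw [hn, hL he, Option.map_some, hgf]

theorem not_stronglyClosed_ex (hη : IsPositive η) : ¬ StronglyClosedUnderUnion ExLearns η := by
  have univ_inf : classCount η (range id) = ⊤ := by simpa using classCount_univ hη.infinite
  by_cases hre : REPred fun y => ¬ η 0 y
  · have compl_inf : classCount η {y | ¬ η 0 y} = ⊤ := by
      have cover : Quotient.mk η '' univ ⊆ insert ⟦0⟧ (Quotient.mk η '' {y | ¬ η 0 y}) := by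
        rintro _ ⟨y, -, rfl⟩
        by_cases hy : η 0 y
        · exact Or.inl (Quotient.sound (η.symm hy))
        · exact Or.inr (mem_image_of_mem _ hy)
      have infinite := (encard_eq_top_iff.1 (classCount_univ hη.infinite)).mono cover
      exact encard_eq_top_iff.2 fun finite => infinite (finite.insert _)
    exact not_stronglyClosed_ex_of_proper hη.re (U := {y | ¬ η 0 y}) hre
      (fun x y hxy hx h => hx (η.trans h (η.symm hxy))) compl_inf (a := 0) (not_not.2 (η.refl 0))
  · have isFamily_chain_id := isFamily_chain hη.re Primrec.id univ_inf
    have isFamily_even := isFamily_comp isFamily_chain_id Primrec.nat_double.to_comp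
      (mul_right_injective₀ two_ne_zero)
    have learnable_even := exactlyLearnable_ex_comp isFamily_chain_id.injective
      (exactlyLearnable_chain hη.re Primrec.id univ_inf) Primrec.nat_div2.to_comp
      (f := fun k => 2 * k) fun k => by simp
    refine not_stronglyClosed_of_disjoint (isFamily_pairFamily hη) isFamily_even
      (pairFamily_ne_chain hη.infinite) (exactlyLearnable_pairFamily hη) learnable_even
      fun W ⟨M, hM, hex⟩ => hre ?_
    refine rePred_of_exLearns_pairSet hη.re hM hex (Or.inr ⟨0, chain_zero⟩) fun y hy => ?_
    exact Or.inl (exists_pairFamily_eq hy)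

end Pairs

section Confident

variable {K : ℕ → Set ℕ} {D : ℕ → ℕ × ℕ → Prop}

/-- The least number at which, at stage `s`, the sets with indices `a` and `b` differ. -/
noncomputable def discrepancy (D : ℕ → ℕ × ℕ → Prop) (a b s : ℕ) : ℕ :=
  leastBelow (fun x => ¬ (D s (a, x) ↔ D s (b, x))) s

/-- The choice between the indices `a` and `b` made according to whether the data `σ` agrees
with the set of index `a` at the discrepancy of the two sets. -/
noncomputable def selectIndex (D : ℕ → ℕ × ℕ → Prop) (a b : ℕ) (σ : List (Option ℕ)) : ℕ :=
  open Classical in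
  if some (discrepancy D a b σ.length) ∈ σ ↔ D σ.length (a, discrepancy D a b σ.length) then a
  else b

theorem computablePred_iff {α : Type*} [Primcodable α] {p q : α → Prop} (hp : ComputablePred p)
    (hq : ComputablePred q) : ComputablePred fun a => p a ↔ q a := by
  classical
  exact ((Primrec.beq.to_comp.comp hp.decide hq.decide).of_eq fun a => by
    by_cases p a <;> by_cases q a <;> simp_all).computablePred

theorem computable_selectIndex (hD : PrimrecPred fun q : ℕ × ℕ × ℕ => D q.1 q.2)
    {f g : List (Option ℕ) → ℕ} (hf : Computable f) (hg : Computable g) :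
    Computable fun σ => selectIndex D (f σ) (g σ) σ := by
  classical
  have stage {α : Type} [Primcodable α] {s i x : α → ℕ} (hs : Computable s) (hi : Computable i)
      (hx : Computable x) : ComputablePred fun a => D (s a) (i a, x a) :=
    computablePred_comp hD.computablePred (hs.pair (hi.pair hx))
  have length : Computable (List.length (α := Option ℕ)) := Computable.list_length
  have point : Computable fun σ => discrepancy D (f σ) (g σ) σ.length :=
    computable_leastBelow (computablePred_iff
      (stage (length.comp Computable.fst) (hf.comp Computable.fst) Computable.snd)
      (stage (length.comp Computable.fst) (hg.comp Computable.fst) Computable.snd)).not length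
  exact computable_ite (computablePred_iff
    (computablePred_comp primrecRel_some_mem.computablePred (point.pair Computable.id))
    (stage length hf point)) hf hg

theorem eventually_discrepancy (hD : IsStaged (fun p : ℕ × ℕ => p.2 ∈ K p.1) D) {a b : ℕ}
    (hab : K a ≠ K b) :
    ∃ z, ¬ (z ∈ K a ↔ z ∈ K b) ∧ ∀ᶠ n in atTop, discrepancy D a b n = z := by
  classical
  have exists_diff : ∃ x, ¬ (x ∈ K a ↔ x ∈ K b) := by
    by_contra! h
    exact hab (Set.ext h)
  have least : IsLeast {x | ¬ (x ∈ K a ↔ x ∈ K b)} (Nat.find exists_diff) :=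
    ⟨Nat.find_spec exists_diff, fun _ => Nat.find_min' exists_diff⟩
  refine ⟨_, least.1, eventually_leastBelow (fun x => ?_) least⟩
  filter_upwards [hD.eventually (a, x), hD.eventually (b, x)] with n ha hb
  rw [ha, hb]

theorem eventually_selectIndex (hD : IsStaged (fun p : ℕ × ℕ => p.2 ∈ K p.1) D)
    (hK : Function.Injective K) (a b : ℕ) (T : Text) :
    ∃ v, (∀ᶠ n in atTop, selectIndex D a b (T.initial n) = v) ∧
      (K a = T.content ∨ K b = T.content → K v = T.content) := by
  classical
  rcases eq_or_ne a b with rfl | hab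
  · exact ⟨a, Eventually.of_forall fun n => ite_self a, or_self_iff.1⟩
  obtain ⟨z, hz, hev⟩ := eventually_discrepancy hD (hK.ne hab)
  refine ⟨if z ∈ T.content ↔ z ∈ K a then a else b, ?_, ?_⟩
  · filter_upwards [hev, T.eventually_mem z, hD.eventually (a, z)] with n hpoint hmem hstage
    simp only [selectIndex, T.length_initial, hpoint, hmem, hstage]
  · rintro (h | h)
    · rw [h, if_pos Iff.rfl, h]
    · rw [← h, if_neg fun h' => hz h'.symm]

theorem stronglyClosed_conf (η : Setoid ℕ) : StronglyClosedUnderUnion ConfLearns η := by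
  rintro L H K - - ⟨M, hM, hML⟩ ⟨N, hN, hNH⟩ ⟨hK, hKU, ⟨f, hf, -, hfK⟩, ⟨g, hg, -, hgK⟩⟩
  obtain ⟨D, hD⟩ := exists_isStaged hK.re
  refine ⟨fun σ => some (selectIndex D (f ((M σ).getD 0)) (g ((N σ).getD 0)) σ), ?_,
    confLearns_of_eventually fun T => ?_⟩
  · exact Computable.option_some.comp (computable_selectIndex hD.primrecPred
      (hf.comp (Computable.option_getD hM (Computable.const 0)))
      (hg.comp (Computable.option_getD hN (Computable.const 0))))
  · obtain ⟨a, ha, hLa⟩ := hML.eventually_getD T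
    obtain ⟨b, hb, hHb⟩ := hNH.eventually_getD T
    obtain ⟨v, hv, hKv⟩ := eventually_selectIndex hD hK.injective (f a) (g b) T
    refine ⟨v, ?_, fun hT => hKv ?_⟩
    · filter_upwards [ha, hb, hv] with n han hbn hvn
      rw [han, hbn, hvn]
    · rw [← hfK, ← hgK]
      exact (hKU ▸ hT).imp hLa hHb

end Confident

section Finite

variable {η : Setoid ℕ}

theorem finLearns_iff {M : Learner} {W : ℕ → Set ℕ} {C : Set (Set ℕ)} :
    FinLearns M W C ↔ ∀ A ∈ C, ∀ T : Text, T.content = A →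
      ∃ n e, W e = A ∧ ∀ j, M (T.initial j) = if n ≤ j then some e else none := by
  refine forall₄_congr fun A _ T _ => exists₂_congr fun n e => ⟨?_, ?_⟩
  · rintro ⟨hn, he, hlt, hle⟩
    refine ⟨he, fun j => ?_⟩
    split_ifs with hj
    · exact (hle j hj).trans hn
    · exact hlt j (not_le.1 hj)
  · rintro ⟨he, h⟩
    refine ⟨by simp [h], he, fun m hm => by simp [h, hm], fun j hj => by simp [h, hj]⟩

theorem FinLearns.eq_of_seqContent_subset {M : Learner} {W : ℕ → Set ℕ} {C : Set (Set ℕ)}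
    (h : FinLearns M W C) {A B : Set ℕ} (hA : A ∈ C) (hB : B ∈ C) {σ : List (Option ℕ)}
    (hσ : M σ ≠ none) (hσA : seqContent σ ⊆ A) (hσB : seqContent σ ⊆ B) : A = B := by
  have correct {A : Set ℕ} (hA : A ∈ C) (hσA : seqContent σ ⊆ A) :
      ∃ e, M σ = some e ∧ W e = A := by
    obtain ⟨T, hT, hTσ⟩ := exists_text_extending hσA
    obtain ⟨n, e, he, hM⟩ := finLearns_iff.1 h A hA T hT
    refine ⟨e, ?_, he⟩
    have hMσ := hM σ.length
    rw [hTσ] at hMσ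
    rw [hMσ, ite_eq_left_iff]
    exact fun hn => absurd (hMσ.trans (if_neg hn)) hσ
  obtain ⟨a, ha, rfl⟩ := correct hA hσA
  obtain ⟨b, hb, rfl⟩ := correct hB hσB
  exact congrArg W (Option.some_injective _ (ha.symm.trans hb))

theorem FinLearns.exists_initial_ne_none {M : Learner} {W : ℕ → Set ℕ} {C : Set (Set ℕ)}
    (h : FinLearns M W C) {T : Text} (hT : T.content ∈ C) : ∃ n, M (T.initial n) ≠ none := by
  obtain ⟨n, e, -, hM⟩ := finLearns_iff.1 h _ hT T rfl
  exact ⟨n, by simp [hM]⟩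

theorem FinLearns.eq_of_subset {M : Learner} {W : ℕ → Set ℕ} {C : Set (Set ℕ)}
    (h : FinLearns M W C) {A B : Set ℕ} (hA : A ∈ C) (hB : B ∈ C) (hAB : A ⊆ B) : A = B := by
  obtain ⟨T, rfl⟩ := exists_text_content_eq A
  obtain ⟨n, hn⟩ := h.exists_initial_ne_none hA
  exact h.eq_of_seqContent_subset hA hB hn (T.seqContent_initial_subset n)
    ((T.seqContent_initial_subset n).trans hAB)

/-- Each `G i` is a characteristic sample of its closure: it is contained in the closure of no
other `G j`. -/
def IsCharacteristic (η : Setoid ℕ) (G : ℕ → List (Option ℕ)) : Prop :=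
  ∀ i j, seqContent (G i) ⊆ etaClosure η (seqContent (G j)) → i = j

theorem exists_isCharacteristic {B : ℕ → Set ℕ} (hB : IsFamily η B) {W : ℕ → Set ℕ}
    (h : Learnable FinLearns W (range B)) :
    ∃ G : ℕ → List (Option ℕ), Computable G ∧ IsCharacteristic η G := by
  classical
  obtain ⟨M, hM, hfin⟩ := h
  obtain ⟨T, hT, hcontent⟩ := exists_primrec_text hB.re
  have converges (i : ℕ) : ∃ n, M ((T i).initial n) ≠ none :=
    hfin.exists_initial_ne_none (hcontent i ▸ mem_range_self i)
  have initial : Computable fun q : ℕ × ℕ => (T q.1).initial q.2 :=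
    (Primrec.list_map (Primrec.list_range.comp Primrec.snd)
      (hT.comp (Primrec.fst.comp Primrec.fst) Primrec.snd).to₂).to_comp
  have test : ComputablePred fun q : ℕ × ℕ => M ((T q.1).initial q.2) ≠ none :=
    (computablePred_comp (Primrec.eq.comp Primrec.id (Primrec.const none)).computablePred
      (hM.comp initial)).not
  refine ⟨fun i => (T i).initial (Nat.find (converges i)),
    initial.comp (Computable.id.pair (Computable.find test converges)), fun i j hij => ?_⟩
  have sample_subset (i : ℕ) : seqContent ((T i).initial (Nat.find (converges i))) ⊆ B i :=
    hcontent i ▸ (T i).seqContent_initial_subset _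
  exact hB.injective (hfin.eq_of_seqContent_subset (mem_range_self i) (mem_range_self j)
    (Nat.find_spec (converges i)) (sample_subset i)
    (hij.trans ((etaClosure_subset_iff (hB.closed j)).2 (sample_subset j))))

namespace IsCharacteristic

variable {G : ℕ → List (Option ℕ)}

theorem comp (hG : IsCharacteristic η G) {f : ℕ → ℕ} (hf : Function.Injective f) :
    IsCharacteristic η (G ∘ f) :=
  fun i j h => hf (hG (f i) (f j) h)

theorem consSeq (hG : IsCharacteristic η G) {σ : List (Option ℕ)}
    (h : ∀ n, ¬ seqContent σ ⊆ etaClosure η (seqContent (G n)))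
    (h' : ∀ n, ¬ seqContent (G n) ⊆ etaClosure η (seqContent σ)) :
    IsCharacteristic η (consSeq σ G) := by
  rintro (_ | i) (_ | j) hij
  · rfl
  · exact absurd hij (h j)
  · exact absurd hij (h' i)
  · exact congrArg _ (hG i j hij)

theorem isFamily (hη : REPred fun p : ℕ × ℕ => η p.1 p.2) (hG : IsCharacteristic η G)
    (hGc : Computable G) : IsFamily η fun i => etaClosure η (seqContent (G i)) where
  re := rePred_etaClosure hη (A := fun i => seqContent (G i)) (computablePred_comp
    primrecRel_some_mem.computablePred (Computable.snd.pair (hGc.comp Computable.fst))).to_re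
  injective i j h := hG i j ((subset_etaClosure _).trans h.subset)
  closed _ := etaClosed_etaClosure _

theorem finite_setOf_subset (hG : IsCharacteristic η G) (σ : List (Option ℕ)) :
    {j | seqContent (G j) ⊆ etaClosure η (seqContent σ)}.Finite := by
  refine Finite.of_finite_image (f := fun j => Quotient.mk η '' seqContent (G j))
    (((finite_seqContent σ).image (Quotient.mk η)).finite_subsets.subset ?_) ?_
  · rintro _ ⟨j, hj, rfl⟩
    exact (image_mono hj).trans (image_mk_etaClosure _).subset
  · intro i _ j _ hij
    refine hG i j fun x hx => ?_
    obtain ⟨y, hy, hyx⟩ := hij.subset (mem_image_of_mem _ hx)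
    exact ⟨y, hy, Quotient.exact hyx⟩

end IsCharacteristic

/-- The least index below the length of `σ` whose sample is contained in `σ`, if any. -/
noncomputable def sampleLearner (G : ℕ → List (Option ℕ)) : Learner := fun σ =>
  let i := leastBelow (fun i => seqContent (G i) ⊆ seqContent σ) σ.length
  if i < σ.length then some i else none

theorem primrecRel_seqContent_subset :
    PrimrecRel fun σ τ : List (Option ℕ) => seqContent σ ⊆ seqContent τ :=
  (primrecRel_some_mem.forall_mem_list.comp₂ (primrec_reduceOption.comp Primrec.fst).to₂
    Primrec₂.right).of_eq fun σ τ => by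
      simp [seqContent, Set.subset_def, List.reduceOption_mem_iff]

theorem computable_sampleLearner {G : ℕ → List (Option ℕ)} (hG : Computable G) :
    Computable (sampleLearner G) := by
  have test : ComputablePred fun q : List (Option ℕ) × ℕ =>
      seqContent (G q.2) ⊆ seqContent q.1 :=
    computablePred_comp primrecRel_seqContent_subset.computablePred
      ((hG.comp Computable.snd).pair Computable.fst)
  have guess := computable_leastBelow (P := fun σ i => seqContent (G i) ⊆ seqContent σ) test
    Computable.list_length
  exact computable_ite (computablePred_comp Primrec.nat_lt.computablePred
    (guess.pair Computable.list_length)) (Computable.option_some.comp guess) (Computable.const none)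

open Classical in
theorem IsCharacteristic.sampleLearner_eq {G : ℕ → List (Option ℕ)} (hG : IsCharacteristic η G)
    {i : ℕ} {σ : List (Option ℕ)} (hσ : seqContent σ ⊆ etaClosure η (seqContent (G i))) :
    sampleLearner G σ =
      if i < σ.length ∧ seqContent (G i) ⊆ seqContent σ then some i else none := by
  have guess := isLeast_leastBelow (fun j => seqContent (G j) ⊆ seqContent σ) σ.length
  rw [sampleLearner]
  generalize leastBelow (fun j => seqContent (G j) ⊆ seqContent σ) σ.length = g at guess ⊢
  have eq_of_lt (hg : g < σ.length) : g = i ∧ seqContent (G g) ⊆ seqContent σ := by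
    have hsub := guess.1.resolve_left hg.not_ge
    exact ⟨hG g i (hsub.trans hσ), hsub⟩
  by_cases h : i < σ.length ∧ seqContent (G i) ⊆ seqContent σ
  · have hg : g < σ.length := (guess.2 (Or.inr h.2)).trans_lt h.1
    rw [if_pos h, if_pos hg, (eq_of_lt hg).1]
  · refine (if_neg fun hg => h ?_).trans (if_neg h).symm
    obtain ⟨rfl, hsub⟩ := eq_of_lt hg
    exact ⟨hg, hsub⟩

theorem IsCharacteristic.exactlyLearnable {G : ℕ → List (Option ℕ)} (hG : IsCharacteristic η G)
    (hGc : Computable G) :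
    ExactlyLearnable FinLearns fun i => etaClosure η (seqContent (G i)) := by
  classical
  refine ⟨sampleLearner G, computable_sampleLearner hGc, finLearns_iff.2 ?_⟩
  rintro _ ⟨i, rfl⟩ T hT
  have seen : ∃ n, i < n ∧ seqContent (G i) ⊆ seqContent (T.initial n) :=
    ((eventually_gt_atTop i).and
      (T.eventually_subset (finite_seqContent _) (hT ▸ subset_etaClosure _))).exists
  refine ⟨Nat.find seen, i, rfl, fun j => ?_⟩
  rw [hG.sampleLearner_eq ((T.seqContent_initial_subset j).trans hT.subset), T.length_initial]
  refine if_congr ⟨fun hj => Nat.find_min' seen hj, fun hj => ?_⟩ rfl rfl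
  obtain ⟨hlt, hsub⟩ := Nat.find_spec seen
  obtain ⟨τ, -, hτ⟩ := T.exists_initial_append hj
  rw [hτ, seqContent_append]
  exact ⟨hlt.trans_le hj, hsub.trans subset_union_left⟩

theorem not_stronglyClosed_fin (hη : REPred fun p : ℕ × ℕ => η p.1 p.2) {B W : ℕ → Set ℕ}
    (hB : IsFamily η B) (h : Learnable FinLearns W (range B)) :
    ¬ StronglyClosedUnderUnion FinLearns η := by
  obtain ⟨G, hGc, hG⟩ := exists_isCharacteristic hB h
  have left_subset : seqContent (G 0) ⊆ seqContent (G 0 ++ G 1) :=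
    seqContent_append _ _ ▸ subset_union_left
  have right_subset : seqContent (G 1) ⊆ seqContent (G 0 ++ G 1) :=
    seqContent_append _ _ ▸ subset_union_right
  obtain ⟨c, hc⟩ := (hG.finite_setOf_subset (G 0 ++ G 1)).bddAbove
  have even := hG.comp (f := fun n => 2 * n) (mul_right_injective₀ two_ne_zero)
  have even_computable := hGc.comp Primrec.nat_double.to_comp
  have odd : IsCharacteristic η (consSeq (G 0 ++ G 1) (G ∘ fun n => 2 * (n + c) + 1)) := by
    refine (hG.comp fun a b hab => by omega).consSeq (fun n hn => ?_) fun n hn => ?_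
    · have : 0 = 2 * (n + c) + 1 := hG _ _ (left_subset.trans hn)
      omega
    · have : 2 * (n + c) + 1 ≤ c := hc hn
      omega
  have odd_computable := computable_consSeq (G 0 ++ G 1) (hGc.comp (Primrec.nat_double_succ.comp
    (Primrec.nat_add.comp Primrec.id (Primrec.const c))).to_comp)
  refine not_stronglyClosed_of_disjoint (even.isFamily hη even_computable)
    (odd.isFamily hη odd_computable) ?_ (even.exactlyLearnable even_computable)
    (odd.exactlyLearnable odd_computable) fun W ⟨M, _, hM⟩ => ?_
  · rintro i (_ | j) hij
    · have : 1 = 2 * i := hG _ _ (right_subset.trans ((subset_etaClosure _).trans hij.superset))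
      omega
    · have : 2 * i = 2 * (j + c) + 1 := hG _ _ ((subset_etaClosure _).trans hij.subset)
      omega
  · have closure_eq := hM.eq_of_subset (Or.inl ⟨0, rfl⟩) (Or.inr ⟨0, rfl⟩)
      ((etaClosure_subset_iff (etaClosed_etaClosure _)).2
        (left_subset.trans (subset_etaClosure _)))
    have := hG 1 0 (right_subset.trans ((subset_etaClosure _).trans closure_eq.superset))
    omega

end Finite

end PosLearn

open PosLearn in
theorem theorem5p5_general (η : Setoid ℕ) :
    StronglyClosedUnderUnion ConfLearns η ∧
    (IsPositive η → ¬ StronglyClosedUnderUnion ExLearns η) ∧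
    (REPred (fun p : ℕ × ℕ => η p.1 p.2) → ∀ B W : ℕ → Set ℕ, IsFamily η B →
      Learnable FinLearns W (Set.range B) → ¬ StronglyClosedUnderUnion FinLearns η) :=
  ⟨stronglyClosed_conf η, not_stronglyClosed_ex, fun hη _ _ => not_stronglyClosed_fin hη⟩

theorem theorem5p5 (η : Setoid ℕ) (hη : PosLearn.IsPositive η) :
    PosLearn.StronglyClosedUnderUnion PosLearn.ConfLearns η ∧
    ¬ PosLearn.StronglyClosedUnderUnion PosLearn.ExLearns η ∧
    ((∃ B : ℕ → Set ℕ, PosLearn.IsFamily η B ∧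
        PosLearn.Learnable PosLearn.FinLearns (PosLearn.closedW η) (Set.range B)) →
      ¬ PosLearn.StronglyClosedUnderUnion PosLearn.FinLearns η) :=
  have ⟨conf, ex, fin⟩ := theorem5p5_general η
  ⟨conf, ex hη, fun ⟨B, hB, hl⟩ => fin hη.re B _ hB hl⟩
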